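/- Let $\mathcal F$ be a finite family of distinct $3$-element subsets of a vertex set $V$ that is linear, i.e. $|A\cap B|\le 1$ for all distinct $A,B\in\mathcal F$. Let $\nu$ be the matching number of $\mathcal F$ (the maximum number of pairwise disjoint members of $\mathcal F$) and let $\Delta$ be its maximum degree (the maximum, over $x\in V$, of the number of members of $\mathcal F$ containing $x$). If $\nu\neq 1$ and $$\Delta\ \ge\ \frac{23}{6}\,\nu\left(1+\frac{1}{\nu-1}\right),$$ then $|\mathcal F|\le\Delta\nu$. Moreover, the bound is attained. Call a family of sets, each of which contains a set $X$, a sunflower with core $X$ if any two distinct members intersect exactly in $X$; its members are its petals. For all integers $\nu\ge 1$ and $\Delta\ge 1$ there is a family $\mathcal F$ that is a union of $\nu$ pairwise vertex-disjoint sunflowers of $3$-element sets, each with $\Delta$ petals and a one-vertex core; and every such family $\mathcal F$ is $3$-uniform and linear, has matching number $\nu$ and maximum degree $\Delta$, and satisfies $|\mathcal F|=\Delta\nu$. -/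

import Mathlib

namespace SetFamily

/-- A family is linear if any two distinct members share at most one vertex. -/
def IsLinear {V : Type*} [DecidableEq V] (F : Finset (Finset V)) : Prop :=
  ∀ A ∈ F, ∀ B ∈ F, A ≠ B → (A ∩ B).card ≤ 1

/-- A matching: a collection of pairwise disjoint sets. -/
abbrev IsMatching {V : Type*} [DecidableEq V] (M : Finset (Finset V)) : Prop :=
  ∀ A ∈ M, ∀ B ∈ M, A ≠ B → Disjoint A B

/-- The size of a maximum matching contained in `F`. -/
def matchingNumber {V : Type*} [DecidableEq V] (F : Finset (Finset V)) : ℕ :=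
  (F.powerset.filter fun M => IsMatching M).sup Finset.card

/-- The set of vertices covered by the members of `F`. -/
def vertices {V : Type*} [DecidableEq V] (F : Finset (Finset V)) : Finset V :=
  F.biUnion id

/-- The number of members of `F` containing `x`. -/
def degree {V : Type*} [DecidableEq V] (F : Finset (Finset V)) (x : V) : ℕ :=
  (F.filter fun A => x ∈ A).card

/-- The maximum degree. Vertices outside all members of `F` have degree `0`, so the maximum may be
taken over the covered vertices (it is `0` if there are none). -/
def maxDegree {V : Type*} [DecidableEq V] (F : Finset (Finset V)) : ℕ :=
  (vertices F).sup (degree F)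

/-- `G` is a sunflower with core `X`, its petals being the members of `G`. (The inclusion `X ⊆ A`
is automatic as soon as there are two petals.) -/
def IsSunflower {V : Type*} [DecidableEq V] (G : Finset (Finset V)) (X : Finset V) : Prop :=
  (∀ A ∈ G, X ⊆ A) ∧ ∀ A ∈ G, ∀ B ∈ G, A ≠ B → A ∩ B = X

/-- `F` is the union of `n` pairwise vertex-disjoint `3`-uniform sunflowers, each with `d` petals
and a one-vertex core. -/
def IsDisjointSunflowers {V : Type*} [DecidableEq V] (F : Finset (Finset V)) (n d : ℕ) : Prop :=
  ∃ G : Fin n → Finset (Finset V),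
    F = Finset.univ.biUnion G ∧
    (∀ i, (G i : Set (Finset V)).Sized 3 ∧ (G i).card = d ∧ ∃ c : V, IsSunflower (G i) {c}) ∧
    ∀ i j, i ≠ j → Disjoint (vertices (G i)) (vertices (G j))

end SetFamily

/-!
Fix a maximum matching `M`, of size `n`. A member of `M` can have at most one vertex with five or
more pendant edges (edges meeting `M` in that vertex only). Such a vertex is called a centre and
the member containing it a star; a star behaves like a petal of a sunflower, since whatever is
rearranged elsewhere, a pendant edge at its centre remains available. Hence every edge avoiding the
centres meets a member of `M` that is not a star.

The edges through a centre are counted by degree, those meeting `M` once by their pendant vertex.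
The remaining ones are counted by weights on pairs of matched vertices, where every edge receives at
least 12. Exchange arguments limit the cross edges: at most 8 between two members of `M` and at most
21 among three, so 7 per pair on average, and a weight of at most 56 between a star and a non-star.
If all degrees are at most `3 * n`, this yields `6 * |F| ≤ 23 * n * (n + 1)`. A vertex of larger
degree is covered by every maximum matching, so deleting it lowers `n` by one at the cost of at most
`Δ` edges, and induction on `n` removes the degree assumption.
-/

namespace SetFamily

open Finset

section Basic

variable {V : Type*} [DecidableEq V] {F M R S : Finset (Finset V)} {A B X : Finset V} {u v x : V}

lemma mem_vertices : v ∈ vertices F ↔ ∃ A ∈ F, v ∈ A := by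
  simp [vertices]

lemma subset_vertices (hA : A ∈ F) : A ⊆ vertices F :=
  subset_biUnion_of_mem id hA

lemma vertices_mono (h : R ⊆ S) : vertices R ⊆ vertices S :=
  biUnion_subset_biUnion_of_subset_left id h

lemma degree_le_maxDegree (F : Finset (Finset V)) (x : V) : degree F x ≤ maxDegree F := by
  by_cases hx : x ∈ vertices F
  · exact le_sup hx
  · have : degree F x = 0 :=
      card_eq_zero.2 <| filter_eq_empty_iff.2 fun A hA hxA ↦ hx (mem_vertices.2 ⟨A, hA, hxA⟩)
    lia

lemma IsLinear.mono (hF : IsLinear F) (h : S ⊆ F) : IsLinear S :=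
  fun A hA B hB ↦ hF A (h hA) B (h hB)

lemma IsLinear.eq_of_mem (hF : IsLinear F) (hA : A ∈ F) (hB : B ∈ F) (huv : u ≠ v)
    (huA : u ∈ A) (hvA : v ∈ A) (huB : u ∈ B) (hvB : v ∈ B) : A = B := by
  by_contra hAB
  exact (hF A hA B hB hAB).not_gt
    (one_lt_card.2 ⟨u, mem_inter.2 ⟨huA, huB⟩, v, mem_inter.2 ⟨hvA, hvB⟩, huv⟩)

lemma IsLinear.exists_disjoint (hS : IsLinear S) (hvS : ∀ A ∈ S, v ∈ A) (hvX : v ∉ X)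
    (hX : X.card < S.card) : ∃ A ∈ S, Disjoint A X := by
  by_contra! h
  have : Nonempty V := ⟨v⟩
  simp only [not_disjoint_iff] at h
  choose! t htA htX using h
  obtain ⟨A, hA, B, hB, hAB, ht⟩ := exists_ne_map_eq_of_card_lt_of_maps_to hX htX
  have hvt : v ≠ t A := fun h ↦ hvX (h ▸ htX A hA)
  exact hAB (hS.eq_of_mem hA hB hvt (hvS A hA) (htA A hA) (hvS B hB) (ht ▸ htA B hB))

lemma IsMatching.mono (hM : IsMatching M) (h : R ⊆ M) : IsMatching R :=
  fun A hA B hB ↦ hM A (h hA) B (h hB)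

lemma IsMatching.eq_of_mem (hM : IsMatching M) (hA : A ∈ M) (hB : B ∈ M) (hvA : v ∈ A)
    (hvB : v ∈ B) : A = B := by
  by_contra h
  exact disjoint_left.1 (hM A hA B hB h) hvA hvB

lemma IsMatching.ne_of_mem (hM : IsMatching M) (hA : A ∈ M) (hB : B ∈ M) (hAB : A ≠ B)
    (hu : u ∈ A) (hv : v ∈ B) : u ≠ v :=
  fun h ↦ hAB (hM.eq_of_mem hA hB hu (h ▸ hv))

lemma IsMatching.sum_vertices {N : Type*} [AddCommMonoid N] (hM : IsMatching M) (f : V → N) :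
    ∑ v ∈ vertices M, f v = ∑ A ∈ M, ∑ v ∈ A, f v :=
  sum_biUnion fun A hA B hB hAB ↦ hM A hA B hB hAB

lemma IsMatching.card_inter_vertices (hM : IsMatching M) (X : Finset V) :
    (X ∩ vertices M).card = ∑ A ∈ M, (X ∩ A).card := by
  rw [vertices, inter_biUnion]
  exact card_biUnion fun A hA B hB hAB ↦
    (hM A hA B hB hAB).mono inter_subset_right inter_subset_right

lemma IsMatching.card_le_matchingNumber (hM : IsMatching M) (hMF : M ⊆ F) :
    M.card ≤ matchingNumber F :=
  le_sup (f := Finset.card) (mem_filter.2 ⟨mem_powerset.2 hMF, hM⟩)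

lemma matchingNumber_le {n : ℕ} (h : ∀ M ⊆ F, IsMatching M → M.card ≤ n) :
    matchingNumber F ≤ n :=
  Finset.sup_le fun M hM ↦ h M (mem_powerset.1 (mem_filter.1 hM).1) (mem_filter.1 hM).2

end Basic

section MaxMatching

variable {V : Type*} [DecidableEq V] {F M R : Finset (Finset V)}

/-- `M` is a matching of maximum size in the family `F`. -/
structure IsMaxMatching (F M : Finset (Finset V)) : Prop where
  subset : M ⊆ F
  isMatching : IsMatching M
  card_eq : M.card = matchingNumber F

lemma exists_isMaxMatching (F : Finset (Finset V)) : ∃ M, IsMaxMatching F M := by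
  have hne : (F.powerset.filter fun M ↦ IsMatching M).Nonempty := ⟨∅, by simp [IsMatching]⟩
  obtain ⟨M, hM, hcard⟩ := exists_mem_eq_sup _ hne Finset.card
  rw [mem_filter, mem_powerset] at hM
  exact ⟨M, hM.1, hM.2, hcard.symm⟩

/-- `Q` could replace `R` in `M`, so it cannot be larger. -/
lemma IsMaxMatching.length_le_card (h : IsMaxMatching F M) (hR : R ⊆ M) {Q : List (Finset V)}
    (hQ : Q.Pairwise Disjoint) (hQF : ∀ E ∈ Q, E ∈ F ∧ E.Nonempty)
    (hQR : ∀ E ∈ Q, E ∩ vertices M ⊆ vertices R) : Q.length ≤ R.card := by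
  have hQnodup : Q.Nodup := by
    refine List.Pairwise.imp_of_mem (fun {E E'} hE _ hdisj hEE' ↦ ?_) hQ
    exact (hQF E hE).2.ne_empty (disjoint_self.1 (hEE' ▸ hdisj))
  have hQM : ∀ E ∈ Q, ∀ A ∈ M \ R, Disjoint E A := by
    refine fun E hE A hA ↦ disjoint_left.2 fun v hvE hvA ↦ ?_
    rw [mem_sdiff] at hA
    obtain ⟨B, hB, hvB⟩ := mem_vertices.1
      (hQR E hE (mem_inter.2 ⟨hvE, subset_vertices hA.1 hvA⟩))
    exact hA.2 (h.isMatching.eq_of_mem hA.1 (hR hB) hvA hvB ▸ hB)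
  have hdisj : Disjoint Q.toFinset (M \ R) := disjoint_left.2 fun E hEQ hEM ↦ by
    rw [List.mem_toFinset] at hEQ
    exact (hQF E hEQ).2.ne_empty (disjoint_self.1 (hQM E hEQ E hEM))
  have hmatching : IsMatching (Q.toFinset ∪ (M \ R)) := by
    intro A hA B hB hAB
    rw [mem_union, List.mem_toFinset] at hA hB
    rcases hA with hA | hA <;> rcases hB with hB | hB
    · exact hQ.forall hA hB hAB
    · exact hQM A hA B hB
    · exact (hQM B hB A hA).symm
    · exact h.isMatching A (sdiff_subset hA) B (sdiff_subset hB) hAB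
  have hsub : Q.toFinset ∪ (M \ R) ⊆ F :=
    union_subset (fun E hE ↦ (hQF E (List.mem_toFinset.1 hE)).1) (sdiff_subset.trans h.subset)
  have hcard := hmatching.card_le_matchingNumber hsub
  rw [card_union_of_disjoint hdisj, List.toFinset_card_of_nodup hQnodup, ← h.card_eq,
    card_sdiff_of_subset hR] at hcard
  have := card_le_card hR
  lia

end MaxMatching

section Pendants

variable {V : Type*} [DecidableEq V] {F M R : Finset (Finset V)} {A E X C : Finset V} {u v w : V}

/-- A maximum matching of a linear family of triples. -/
structure IsMaxTripleMatching (F M : Finset (Finset V)) : Prop extends IsMaxMatching F M where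
  sized : (F : Set (Finset V)).Sized 3
  isLinear : IsLinear F

/-- The edges whose only matched vertex is `v`. -/
def pendants (F M : Finset (Finset V)) (v : V) : Finset (Finset V) :=
  F.filter fun E ↦ E ∩ vertices M = {v}

/-- The matched vertices with at least five pendant edges: by linearity, whenever at most four
unmatched vertices are in use, such a vertex still has an unhindered pendant edge. -/
def centres (F M : Finset (Finset V)) : Finset V :=
  (vertices M).filter fun v ↦ 5 ≤ (pendants F M v).card

/-- The members of the matching that contain a centre. -/
def stars (F M : Finset (Finset V)) : Finset (Finset V) :=
  M.filter fun A ↦ ∃ v ∈ A, v ∈ centres F M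

lemma mem_pendants : E ∈ pendants F M v ↔ E ∈ F ∧ E ∩ vertices M = {v} := mem_filter

lemma mem_of_mem_pendants (hE : E ∈ pendants F M v) : v ∈ E :=
  inter_subset_left ((mem_pendants.1 hE).2 ▸ mem_singleton_self v)

lemma eq_of_mem_pendants (hE : E ∈ pendants F M v) (hw : w ∈ E) (hwM : w ∈ vertices M) :
    w = v :=
  mem_singleton.1 ((mem_pendants.1 hE).2 ▸ mem_inter.2 ⟨hw, hwM⟩)

lemma centres_subset : centres F M ⊆ vertices M := filter_subset _ _

lemma stars_subset : stars F M ⊆ M := filter_subset _ _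

namespace IsMaxTripleMatching

lemma card_eq_three (h : IsMaxTripleMatching F M) (hA : A ∈ M) : A.card = 3 :=
  h.sized (h.subset hA)

lemma nonempty (h : IsMaxTripleMatching F M) (hE : E ∈ F) : E.Nonempty :=
  card_pos.1 (by rw [h.sized hE]; norm_num)

lemma exists_pendant_disjoint (h : IsMaxTripleMatching F M) (hvX : v ∉ X)
    (hX : X.card < (pendants F M v).card) : ∃ E ∈ pendants F M v, Disjoint E X :=
  (h.isLinear.mono (filter_subset _ _)).exists_disjoint (fun _ ↦ mem_of_mem_pendants) hvX hX

lemma card_sdiff_of_mem_pendants (h : IsMaxTripleMatching F M) (hE : E ∈ pendants F M v) :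
    (E \ vertices M).card = 2 := by
  rw [mem_pendants] at hE
  have := card_inter_add_card_sdiff E (vertices M)
  rw [hE.2, card_singleton, h.sized hE.1] at this
  lia

/-- Enlarge `Q` by a pendant edge at each centre in `C`, choosing these edges one after the other;
`X` collects the unmatched vertices used so far. -/
lemma length_add_card_le (h : IsMaxTripleMatching F M) (hR : R ⊆ M) {Q : List (Finset V)}
    (hX : Disjoint X (vertices M)) (hC : C ⊆ centres F M) (hCR : C ⊆ vertices R)
    (hcard : X.card + 2 * C.card ≤ 6) (hQ : Q.Pairwise Disjoint)
    (hQF : ∀ E ∈ Q, E ∈ F ∧ Disjoint E C ∧ E ⊆ X ∪ vertices R) :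
    Q.length + C.card ≤ R.card := by
  induction C using Finset.induction_on generalizing X Q with
  | empty =>
    rw [card_empty, add_zero]
    refine h.length_le_card hR hQ (fun E hE ↦ ⟨(hQF E hE).1, h.nonempty (hQF E hE).1⟩) ?_
    intro E hE v hv
    rw [mem_inter] at hv
    exact (mem_union.1 ((hQF E hE).2.2 hv.1)).resolve_left fun hvX ↦ disjoint_left.1 hX hvX hv.2
  | insert v C hvC ih =>
    rw [card_insert_of_notMem hvC] at hcard ⊢
    have hvM := centres_subset (hC (mem_insert_self v C))
    obtain ⟨P, hP, hPX⟩ := h.exists_pendant_disjoint (disjoint_right.1 hX hvM)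
      (show X.card < (pendants F M v).card by
        have := (mem_filter.1 (hC (mem_insert_self v C))).2
        lia)
    have hPR : P ⊆ (X ∪ P \ vertices M) ∪ vertices R := fun w hw ↦ by
      by_cases hwM : w ∈ vertices M
      · exact mem_union_right _ (eq_of_mem_pendants hP hw hwM ▸ hCR (mem_insert_self v C))
      · exact mem_union_left _ (mem_union_right _ (mem_sdiff.2 ⟨hw, hwM⟩))
    have hPC : Disjoint P C := disjoint_left.2 fun w hwP hwC ↦
      hvC (eq_of_mem_pendants hP hwP (centres_subset (hC (mem_insert_of_mem hwC))) ▸ hwC)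
    have hPQ : ∀ E ∈ Q, Disjoint P E := fun E hE ↦ disjoint_left.2 fun w hwP hwE ↦ by
      rcases mem_union.1 ((hQF E hE).2.2 hwE) with hwX | hwR
      · exact disjoint_left.1 hPX hwP hwX
      · have hwv := eq_of_mem_pendants hP hwP (vertices_mono hR hwR)
        exact disjoint_left.1 (hQF E hE).2.1 hwE (hwv ▸ mem_insert_self v C)
    have := ih (X := X ∪ P \ vertices M) (Q := P :: Q)
      (disjoint_union_left.2 ⟨hX, sdiff_disjoint⟩) ((subset_insert _ _).trans hC)
      ((subset_insert _ _).trans hCR)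
      (by have := card_union_le X (P \ vertices M); have := h.card_sdiff_of_mem_pendants hP; lia)
      (List.pairwise_cons.2 ⟨hPQ, hQ⟩)
      (List.forall_mem_cons.2 ⟨⟨(mem_pendants.1 hP).1, hPC, hPR⟩, fun E hE ↦ ⟨(hQF E hE).1,
        (hQF E hE).2.1.mono_right (subset_insert _ _),
        (hQF E hE).2.2.trans (union_subset_union_left subset_union_left)⟩⟩)
    rw [List.length_cons] at this
    lia

/-- Otherwise one pendant edge at `u` and a disjoint one at `v` could replace `A`. -/
lemma pendants_eq_empty (h : IsMaxTripleMatching F M) (hA : A ∈ M) (hu : u ∈ A) (hv : v ∈ A)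
    (huv : u ≠ v) (hcard : 3 ≤ (pendants F M u).card) : pendants F M v = ∅ := by
  refine eq_empty_of_forall_notMem fun E hE ↦ ?_
  have huE : u ∉ E := fun huE ↦ huv (eq_of_mem_pendants hE huE (subset_vertices hA hu))
  obtain ⟨E', hE', hdisj⟩ := h.exists_pendant_disjoint (X := E \ vertices M)
    (fun hu' ↦ huE (sdiff_subset hu')) (by rw [h.card_sdiff_of_mem_pendants hE]; lia)
  have hEE' : Disjoint E E' := disjoint_left.2 fun w hwE hwE' ↦ by
    by_cases hwM : w ∈ vertices M
    · exact huE (eq_of_mem_pendants hE' hwE' hwM ▸ hwE)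
    · exact disjoint_left.1 hdisj hwE' (mem_sdiff.2 ⟨hwE, hwM⟩)
  have hmem : ∀ P ∈ [E, E'], ∃ w ∈ A, P ∈ pendants F M w := by
    simpa using And.intro ⟨v, hv, hE⟩ ⟨u, hu, hE'⟩
  have := h.length_le_card (singleton_subset_iff.2 hA) (Q := [E, E']) (by simpa using hEE')
    (fun P hP ↦ let ⟨_, _, hPw⟩ := hmem P hP
      ⟨(mem_pendants.1 hPw).1, h.nonempty (mem_pendants.1 hPw).1⟩)
    (fun P hP ↦ by
      obtain ⟨w, hw, hPw⟩ := hmem P hP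
      rw [(mem_pendants.1 hPw).2]
      simpa [vertices] using hw)
  simp at this

lemma eq_of_mem_centres (h : IsMaxTripleMatching F M) (hA : A ∈ M) (hu : u ∈ A)
    (huC : u ∈ centres F M) (hv : v ∈ A) (hvC : v ∈ centres F M) : u = v := by
  by_contra huv
  have hu5 := (mem_filter.1 huC).2
  have hv5 := (mem_filter.1 hvC).2
  rw [h.pendants_eq_empty hA hu hv huv (by lia), card_empty] at hv5
  lia

lemma card_centres_inter_of_mem_stars (h : IsMaxTripleMatching F M) (hA : A ∈ stars F M) :
    (centres F M ∩ A).card = 1 := by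
  obtain ⟨hAM, v, hvA, hvC⟩ := mem_filter.1 hA
  refine card_eq_one.2 ⟨v, eq_singleton_iff_unique_mem.2 ⟨mem_inter.2 ⟨hvC, hvA⟩, fun u hu ↦ ?_⟩⟩
  exact h.eq_of_mem_centres hAM (mem_inter.1 hu).2 (mem_inter.1 hu).1 hvA hvC

lemma card_centres_inter_vertices (h : IsMaxTripleMatching F M) (hR : R ⊆ stars F M) :
    (centres F M ∩ vertices R).card = R.card := by
  rw [(h.isMatching.mono (hR.trans stars_subset)).card_inter_vertices, card_eq_sum_ones]
  exact sum_congr rfl fun A hA ↦ h.card_centres_inter_of_mem_stars (hR hA)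

lemma card_centres (h : IsMaxTripleMatching F M) : (centres F M).card = (stars F M).card := by
  rw [← h.card_centres_inter_vertices subset_rfl, inter_eq_left.2 fun v hv ↦ ?_]
  obtain ⟨A, hA, hvA⟩ := mem_vertices.1 (centres_subset hv)
  exact mem_vertices.2 ⟨A, mem_filter.2 ⟨hA, v, hvA, hv⟩, hvA⟩

lemma sum_card_pendants_le (h : IsMaxTripleMatching F M) (hA : A ∈ M \ stars F M) :
    ∑ v ∈ A, (pendants F M v).card ≤ 6 := by
  obtain ⟨hAM, hAS⟩ := mem_sdiff.1 hA
  by_cases hthree : ∃ u ∈ A, 3 ≤ (pendants F M u).card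
  · obtain ⟨u, hu, hu3⟩ := hthree
    have hu4 : (pendants F M u).card < 5 := by
      by_contra! hu5
      exact hAS (mem_filter.2 ⟨hAM, u, hu, mem_filter.2 ⟨subset_vertices hAM hu, hu5⟩⟩)
    rw [sum_eq_single_of_mem u hu fun v hv hvu ↦ by
      rw [h.pendants_eq_empty hAM hu hv hvu.symm hu3, card_empty]]
    lia
  · push Not at hthree
    have := sum_le_card_nsmul A (fun v ↦ (pendants F M v).card) 2 fun v hv ↦ by
      have := hthree v hv
      lia
    rw [h.card_eq_three hAM] at this
    simpa using this

/-- An edge avoiding the centres and all matched vertices outside the stars could be added to the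
pendant edges at the centres of the stars it meets. -/
lemma not_disjoint_vertices_sdiff_stars (h : IsMaxTripleMatching F M) (hE : E ∈ F)
    (hEC : Disjoint E (centres F M)) : ¬Disjoint E (vertices (M \ stars F M)) := by
  intro hdisj
  set R := (stars F M).filter fun A ↦ (E ∩ A).Nonempty
  have hRM : R ⊆ M := (filter_subset _ _).trans stars_subset
  have hER : E ∩ vertices M ⊆ vertices R := fun v hv ↦ by
    rw [mem_inter] at hv
    obtain ⟨A, hA, hvA⟩ := mem_vertices.1 hv.2
    have hAS : A ∈ stars F M := by
      by_contra hAS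
      exact disjoint_left.1 hdisj hv.1 (subset_vertices (mem_sdiff.2 ⟨hA, hAS⟩) hvA)
    exact mem_vertices.2 ⟨A, mem_filter.2 ⟨hAS, v, mem_inter.2 ⟨hv.1, hvA⟩⟩, hvA⟩
  have hRE : R.card ≤ (E ∩ vertices M).card := by
    rw [h.isMatching.card_inter_vertices, card_eq_sum_ones]
    exact (sum_le_sum fun A hA ↦ card_pos.2 (mem_filter.1 hA).2).trans
      (sum_le_sum_of_subset hRM)
  have hcard := h.card_centres_inter_vertices (filter_subset _ _ : R ⊆ stars F M)
  have hE3 : (E ∩ vertices M).card + (E \ vertices M).card = 3 :=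
    (card_inter_add_card_sdiff E (vertices M)).trans (h.sized hE)
  have := h.length_add_card_le hRM (Q := [E]) (X := E \ vertices M) sdiff_disjoint
    inter_subset_left inter_subset_right (by
      have := card_le_card (inter_subset_left : E ∩ vertices M ⊆ E)
      rw [h.sized hE] at this
      lia) (List.pairwise_singleton _ _)
    (by
      refine List.forall_mem_singleton.2 ⟨hE, hEC.mono_right inter_subset_left, fun v hv ↦ ?_⟩
      by_cases hvM : v ∈ vertices M
      · exact mem_union_right _ (hER (mem_inter.2 ⟨hv, hvM⟩))
      · exact mem_union_left _ (mem_sdiff.2 ⟨hv, hvM⟩))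
  rw [hcard, List.length_singleton] at this
  lia

end IsMaxTripleMatching

end Pendants

section CrossEdges

variable {V : Type*} [DecidableEq V] {F M R : Finset (Finset V)} {A B G C : Finset V}
  {k p u u' v v' x y w : V}

/-- `{u, v, x}` is an edge joining two matched vertices `u` and `v` to an unmatched tip `x`. -/
structure IsCrossEdge (F M : Finset (Finset V)) (u v x : V) : Prop where
  left_mem : u ∈ vertices M
  right_mem : v ∈ vertices M
  tip_notMem : x ∉ vertices M
  mem : {u, v, x} ∈ F

/-- Two matched vertices forming an edge together with some unmatched vertex. -/
def IsCrossPair (F M : Finset (Finset V)) (u v : V) : Prop :=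
  ∃ x, IsCrossEdge F M u v x

open scoped Classical in
/-- The number of vertices of `A` forming a cross pair with `u`. -/
noncomputable def crossDegree (F M : Finset (Finset V)) (u : V) (A : Finset V) : ℕ :=
  (A.filter (IsCrossPair F M u)).card

/-- The number of cross pairs in `A × B`. -/
noncomputable def crossCount (F M : Finset (Finset V)) (A B : Finset V) : ℕ :=
  ∑ u ∈ A, crossDegree F M u B

lemma IsCrossEdge.symm (h : IsCrossEdge F M u v x) : IsCrossEdge F M v u x :=
  ⟨h.right_mem, h.left_mem, h.tip_notMem, insert_comm u v {x} ▸ h.mem⟩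

lemma isCrossPair_comm : IsCrossPair F M u v ↔ IsCrossPair F M v u :=
  ⟨fun ⟨x, hx⟩ ↦ ⟨x, hx.symm⟩, fun ⟨x, hx⟩ ↦ ⟨x, hx.symm⟩⟩

open scoped Classical in
lemma crossCount_eq_card_filter_product (F M : Finset (Finset V)) (A B : Finset V) :
    crossCount F M A B = ((A ×ˢ B).filter fun t ↦ IsCrossPair F M t.1 t.2).card := by
  simp only [crossCount, crossDegree, card_filter, sum_product]

lemma crossCount_comm (F M : Finset (Finset V)) (A B : Finset V) :
    crossCount F M A B = crossCount F M B A := by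
  classical
  simp only [crossCount, crossDegree, card_filter]
  rw [sum_comm]
  simp only [isCrossPair_comm]

lemma crossDegree_le_card (F M : Finset (Finset V)) (u : V) (A : Finset V) :
    crossDegree F M u A ≤ A.card := by
  classical
  exact card_filter_le _ _

lemma exists_eq_insert_of_card_eq_three (hA : A.card = 3) (hp : p ∈ A) :
    ∃ u u', [u, u', p].Nodup ∧ A = {u, u', p} := by
  obtain ⟨u, u', huu', hA'⟩ := card_eq_two.1 ((card_erase_of_mem hp).trans (by rw [hA]))
  have hne : ∀ w ∈ A.erase p, w ≠ p := fun w ↦ ne_of_mem_erase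
  refine ⟨u, u', by simp_all, ?_⟩
  rw [← insert_erase hp, hA']
  grind

namespace IsMaxTripleMatching

lemma ne_of_isCrossEdge (h : IsMaxTripleMatching F M) (huv : IsCrossEdge F M u v x) : u ≠ v := by
  rintro rfl
  have := h.sized huv.mem
  rw [insert_idem] at this
  exact absurd (card_le_two (a := u) (b := x)) (by lia)

lemma eq_of_isCrossEdge (h : IsMaxTripleMatching F M) (huv : IsCrossEdge F M u v x)
    (huv' : IsCrossEdge F M u v' x) : v = v' := by
  have hux : u ≠ x := fun hux ↦ huv.tip_notMem (hux ▸ huv.left_mem)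
  have heq := h.isLinear.eq_of_mem huv.mem huv'.mem hux (by simp) (by simp) (by simp) (by simp)
  have hv : v ∈ ({u, v', x} : Finset V) := heq ▸ by simp
  have hvu := h.ne_of_isCrossEdge huv
  have hvx : v ≠ x := fun hvx ↦ huv.tip_notMem (hvx ▸ huv.right_mem)
  grind

lemma tip_ne_of_isCrossEdge (h : IsMaxTripleMatching F M) (huv : IsCrossEdge F M u v x)
    (huv' : IsCrossEdge F M u v' y) (hvv' : v ≠ v') : x ≠ y := by
  rintro rfl
  exact hvv' (h.eq_of_isCrossEdge huv huv')

/-- The edges `{u, v, x}` with `(u, v, x)` in `L`, together with pendant edges at the vertices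
of `C`, could replace `R`. -/
lemma length_add_card_le_of_isCrossEdge (h : IsMaxTripleMatching F M) (hR : R ⊆ M)
    {L : List (V × V × V)} (hC : C ⊆ centres F M) (hCR : C ⊆ vertices R)
    (hcard : L.length + 2 * C.card ≤ 6) (hL : ∀ t ∈ L, IsCrossEdge F M t.1 t.2.1 t.2.2)
    (hLR : ∀ t ∈ L, t.1 ∈ vertices R \ C ∧ t.2.1 ∈ vertices R \ C)
    (hends : L.Pairwise fun s t ↦ Disjoint ({s.1, s.2.1} : Finset V) {t.1, t.2.1})
    (htips : (L.map fun t ↦ t.2.2).Nodup) : L.length + C.card ≤ R.card := by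
  set X := (L.map fun t ↦ t.2.2).toFinset
  have hX : Disjoint X (vertices M) := disjoint_left.2 fun x hx ↦ by
    obtain ⟨t, ht, rfl⟩ := List.mem_map.1 (List.mem_toFinset.1 hx)
    exact (hL t ht).tip_notMem
  have hXcard : X.card ≤ L.length := (List.toFinset_card_le _).trans_eq (List.length_map _)
  have hQ : (L.map fun t ↦ ({t.1, t.2.1, t.2.2} : Finset V)).Pairwise Disjoint := by
    refine List.pairwise_map.2 (List.Pairwise.imp_of_mem (fun {s t} hs ht hst ↦ ?_)
      (hends.and (List.pairwise_map.1 htips)))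
    obtain ⟨hs₁, hs₂, hs₃, -⟩ := hL s hs
    obtain ⟨ht₁, ht₂, ht₃, -⟩ := hL t ht
    simp only [disjoint_insert_right, disjoint_singleton_right, mem_insert,
      mem_singleton] at hst ⊢
    grind
  have := h.length_add_card_le hR hX hC hCR (by lia) hQ (List.forall_mem_map.2 fun t ht ↦ ?_)
  · rwa [List.length_map] at this
  have hxX : t.2.2 ∈ X := List.mem_toFinset.2 (List.mem_map_of_mem ht)
  have hxC : t.2.2 ∉ C := fun hx ↦ (hL t ht).tip_notMem (centres_subset (hC hx))
  have hends := hLR t ht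
  simp only [mem_sdiff] at hends
  refine ⟨(hL t ht).mem, ?_, ?_⟩
  · simp only [disjoint_insert_left, disjoint_singleton_left]
    exact ⟨hends.1.2, hends.2.2, hxC⟩
  · simp only [insert_subset_iff, singleton_subset_iff, mem_union]
    exact ⟨.inr hends.1.1, .inr hends.2.1, .inl hxX⟩

lemma tip_eq_of_three (h : IsMaxTripleMatching F M) (hA : A ∈ M) (hB : B ∈ M) (hAB : A ≠ B)
    {u₁ u₂ u₃ v₁ v₂ v₃ x₁ x₂ x₃ : V} (hu : [u₁, u₂, u₃].Nodup) (hv : [v₁, v₂, v₃].Nodup)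
    (huA : {u₁, u₂, u₃} ⊆ A) (hvB : {v₁, v₂, v₃} ⊆ B) (h₁ : IsCrossEdge F M u₁ v₁ x₁)
    (h₂ : IsCrossEdge F M u₂ v₂ x₂) (h₃ : IsCrossEdge F M u₃ v₃ x₃) :
    x₁ = x₂ ∨ x₁ = x₃ ∨ x₂ = x₃ := by
  by_contra! hx
  have hne : ∀ u ∈ A, ∀ v ∈ B, u ≠ v := fun u hu v hv ↦ h.isMatching.ne_of_mem hA hB hAB hu hv
  simp only [insert_subset_iff, singleton_subset_iff, List.nodup_cons, List.mem_cons,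
    List.not_mem_nil, or_false] at hu hv huA hvB
  have := h.length_add_card_le_of_isCrossEdge (R := {A, B})
    (L := [(u₁, v₁, x₁), (u₂, v₂, x₂), (u₃, v₃, x₃)]) (C := ∅) (by grind) (by simp) (by simp)
    (by simp) (by simp [h₁, h₂, h₃]) (by simp [vertices]; grind) (by simp; grind) (by simp; grind)
  rw [card_pair hAB] at this
  simp at this

lemma tip_eq_of_four (h : IsMaxTripleMatching F M) (hA : A ∈ M) (hB : B ∈ M) (hG : G ∈ M)
    (hAB : A ≠ B) (hAG : A ≠ G) (hBG : B ≠ G) {u₁ u₂ u₃ v₁ v₂ v₃ x₁ x₂ x₃ x₄ : V}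
    (hu : [u₁, u₂, u₃].Nodup) (hv : [v₁, v₂, v₃].Nodup) (huA : {u₁, u₂, u₃} ⊆ A)
    (hvB : {v₁, v₂, v₃} ⊆ B) (hk : k ∈ G) (hw : w ∈ G) (hkw : k ≠ w)
    (h₁ : IsCrossEdge F M u₁ k x₁) (h₂ : IsCrossEdge F M v₁ w x₂)
    (h₃ : IsCrossEdge F M u₂ v₂ x₃) (h₄ : IsCrossEdge F M u₃ v₃ x₄) :
    x₁ = x₂ ∨ x₁ = x₃ ∨ x₁ = x₄ ∨ x₂ = x₃ ∨ x₂ = x₄ ∨ x₃ = x₄ := by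
  by_contra! hx
  have hneAB : ∀ u ∈ A, ∀ v ∈ B, u ≠ v := fun u hu v hv ↦ h.isMatching.ne_of_mem hA hB hAB hu hv
  have hneAG : ∀ u ∈ A, ∀ v ∈ G, u ≠ v := fun u hu v hv ↦ h.isMatching.ne_of_mem hA hG hAG hu hv
  have hneBG : ∀ u ∈ B, ∀ v ∈ G, u ≠ v := fun u hu v hv ↦ h.isMatching.ne_of_mem hB hG hBG hu hv
  simp only [insert_subset_iff, singleton_subset_iff, List.nodup_cons, List.mem_cons,
    List.not_mem_nil, or_false] at hu hv huA hvB
  have := h.length_add_card_le_of_isCrossEdge (R := {A, B, G})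
    (L := [(u₁, k, x₁), (v₁, w, x₂), (u₂, v₂, x₃), (u₃, v₃, x₄)]) (C := ∅) (by grind) (by simp)
    (by simp) (by simp) (by simp [h₁, h₂, h₃, h₄]) (by simp [vertices]; grind) (by simp; grind)
    (by simp; grind)
  simp only [List.length_cons, List.length_nil] at this
  have := card_le_three (a := A) (b := B) (c := G)
  lia

/-- Two cross edges with distinct tips between a star and another member, missing the centre of
the star, could be completed by a pendant edge at that centre. -/
lemma tip_eq_of_mem_stars (h : IsMaxTripleMatching F M) (hA : A ∈ stars F M) (hB : B ∈ M)
    (hAB : A ≠ B) (hu : u ∈ A \ centres F M) (hu' : u' ∈ A \ centres F M) (huu' : u ≠ u')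
    (hv : v ∈ B) (hv' : v' ∈ B) (hvv' : v ≠ v')
    (huv : IsCrossEdge F M u v x) (huv' : IsCrossEdge F M u' v' y) : x = y := by
  by_contra hxy
  obtain ⟨hAM, c, hcA, hc⟩ := mem_filter.1 hA
  rw [mem_sdiff] at hu hu'
  have hne : ∀ u ∈ A, ∀ v ∈ B, u ≠ v := fun u hu v hv ↦ h.isMatching.ne_of_mem hAM hB hAB hu hv
  have := h.length_add_card_le_of_isCrossEdge (R := {A, B}) (L := [(u, v, x), (u', v', y)])
    (C := {c}) (by grind) (by simpa using hc) (by simp [vertices, hcA]) (by simp)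
    (by simp [huv, huv']) (by simp [vertices]; grind) (by simp; grind) (by simp [hxy])
  rw [card_pair hAB] at this
  simp at this

lemma crossDegree_le_two (h : IsMaxTripleMatching F M) (A : Finset V) (k x : V)
    (hx : ∀ w ∈ A, w ≠ k → ∀ y, IsCrossEdge F M v w y → y = x) : crossDegree F M v A ≤ 2 := by
  classical
  have hone : ((A.filter (IsCrossPair F M v)).erase k).card ≤ 1 := by
    refine card_le_one.2 fun w hw w' hw' ↦ ?_
    obtain ⟨hwk, hwA, y, hy⟩ : w ≠ k ∧ w ∈ A ∧ IsCrossPair F M v w := by simpa using hw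
    obtain ⟨hwk', hwA', y', hy'⟩ : w' ≠ k ∧ w' ∈ A ∧ IsCrossPair F M v w' := by simpa using hw'
    obtain rfl := hx w hwA hwk y hy
    obtain rfl := hx w' hwA' hwk' y' hy'
    exact h.eq_of_isCrossEdge hy hy'
  have hle : crossDegree F M v A - 1 ≤ _ := pred_card_le_card_erase (a := k)
  lia

lemma exists_tip_notMem (h : IsMaxTripleMatching F M) (X : Finset V)
    (hX : X.card < crossDegree F M u A) : ∃ k ∈ A, ∃ x ∉ X, IsCrossEdge F M u k x := by
  classical
  by_contra! hcon
  have : Nonempty V := ⟨u⟩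
  have hmem : ∀ w ∈ A.filter (IsCrossPair F M u), w ∈ A ∧ IsCrossPair F M u w :=
    fun w ↦ mem_filter.1
  choose! t ht using fun w hw ↦ (hmem w hw).2
  obtain ⟨w, hw, w', hw', hne, htw⟩ := exists_ne_map_eq_of_card_lt_of_maps_to hX fun w hw ↦
    not_not.1 fun htX ↦ hcon w (hmem w hw).1 (t w) htX (ht w hw)
  exact hne (h.eq_of_isCrossEdge (ht w hw) (htw ▸ ht w' hw'))

end IsMaxTripleMatching

end CrossEdges

section RichPairs

variable {V : Type*} [DecidableEq V] {F M : Finset (Finset V)} {e f g : Finset V}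
  {u v u' v' p q a b c d : V}

/-- The configuration forced by eight cross pairs between two members `e = {u, u', p}` and
`f = {v, v', q}` of a maximum matching: the tips of the cross edges. Only the pair `(p, q)` is not
prescribed. -/
structure IsRich (F M : Finset (Finset V)) (e f : Finset V) (u v u' v' p q a b c d : V) :
    Prop where
  left_mem : e ∈ M
  right_mem : f ∈ M
  ne : e ≠ f
  left_eq : e = {u, u', p}
  right_eq : f = {v, v', q}
  left_nodup : [u, u', p].Nodup
  right_nodup : [v, v', q].Nodup
  u_v : IsCrossEdge F M u v a
  v_u' : IsCrossEdge F M v u' b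
  u'_v' : IsCrossEdge F M u' v' c
  v'_u : IsCrossEdge F M v' u d
  u_q : IsCrossEdge F M u q c
  v_p : IsCrossEdge F M v p d
  u'_q : IsCrossEdge F M u' q a
  v'_p : IsCrossEdge F M v' p b

namespace IsRich

lemma rotate (r : IsRich F M e f u v u' v' p q a b c d) :
    IsRich F M f e v u' v' u q p b c d a where
  left_mem := r.right_mem
  right_mem := r.left_mem
  ne := r.ne.symm
  left_eq := r.right_eq
  right_eq := by rw [r.left_eq, insert_comm]
  left_nodup := r.right_nodup
  right_nodup := (List.Perm.swap _ _ _).nodup r.left_nodup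
  u_v := r.v_u'
  v_u' := r.u'_v'
  u'_v' := r.v'_u
  v'_u := r.u_v
  u_q := r.v_p
  v_p := r.u'_q
  u'_q := r.v'_p
  v'_p := r.u_q

lemma crossCount_left (r : IsRich F M e f u v u' v' p q a b c d) (g : Finset V) :
    crossCount F M e g = crossDegree F M u g + crossDegree F M u' g + crossDegree F M p g := by
  have := r.left_nodup
  simp only [List.nodup_cons, List.mem_cons, List.not_mem_nil, or_false, not_or] at this
  rw [crossCount, r.left_eq, sum_insert (by simpa using this.1), sum_pair this.2.1, add_assoc]

lemma crossDegree_le_two (h : IsMaxTripleMatching F M)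
    (r : IsRich F M e f u v u' v' p q a b c d) (hg : g ∈ M) (heg : e ≠ g) (hfg : f ≠ g)
    (hu : 2 ≤ crossDegree F M u g) : crossDegree F M v g ≤ 2 := by
  obtain ⟨k, hk, x, hxb, hx⟩ := h.exists_tip_notMem {b} (by rwa [card_singleton])
  refine h.crossDegree_le_two g k x fun w hw hwk y hy ↦ ?_
  have huv := h.tip_ne_of_isCrossEdge hx r.u_v
    (h.isMatching.ne_of_mem hg r.right_mem hfg.symm hk (by simp [r.right_eq]))
  have hvu := h.tip_ne_of_isCrossEdge hy r.u_v.symm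
    (h.isMatching.ne_of_mem hg r.left_mem heg.symm hw (by simp [r.left_eq]))
  have hvu' := h.tip_ne_of_isCrossEdge hy r.v_u'
    (h.isMatching.ne_of_mem hg r.left_mem heg.symm hw (by simp [r.left_eq]))
  have huu' := h.tip_ne_of_isCrossEdge r.u_v.symm r.v_u' (by have := r.left_nodup; grind)
  have := h.tip_eq_of_four r.left_mem r.right_mem hg r.ne heg hfg r.left_nodup
    (v₁ := v) (v₂ := q) (v₃ := v') (by have := r.right_nodup; grind) r.left_eq.ge
    (by rw [r.right_eq]; grind) hk hw hwk.symm hx hy r.u'_q r.v'_p.symm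
  rw [mem_singleton] at hxb
  tauto

lemma crossDegree_le_two_of_three_le (h : IsMaxTripleMatching F M)
    (r : IsRich F M e f u v u' v' p q a b c d) (hg : g ∈ M) (heg : e ≠ g) (hfg : f ≠ g)
    (hp : 3 ≤ crossDegree F M p g) : crossDegree F M q g ≤ 2 := by
  obtain ⟨k, hk, x, hxac, hx⟩ := h.exists_tip_notMem {a, c} (card_le_two.trans_lt hp)
  refine h.crossDegree_le_two g k x fun w hw hwk y hy ↦ ?_
  have hqu := h.tip_ne_of_isCrossEdge hy r.u_q.symm
    (h.isMatching.ne_of_mem hg r.left_mem heg.symm hw (by simp [r.left_eq]))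
  have hqu' := h.tip_ne_of_isCrossEdge hy r.u'_q.symm
    (h.isMatching.ne_of_mem hg r.left_mem heg.symm hw (by simp [r.left_eq]))
  have hvq := h.tip_ne_of_isCrossEdge r.u_v r.u_q (by have := r.right_nodup; grind)
  have := h.tip_eq_of_four r.left_mem r.right_mem hg r.ne heg hfg (u₁ := p) (u₂ := u) (u₃ := u')
    (v₁ := q) (v₂ := v) (v₃ := v') (by have := r.left_nodup; grind)
    (by have := r.right_nodup; grind) (by rw [r.left_eq]; grind) (by rw [r.right_eq]; grind)
    hk hw hwk.symm hx hy r.u_v r.u'_v'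
  simp only [mem_insert, mem_singleton, not_or] at hxac
  tauto

lemma crossCount_add_le (h : IsMaxTripleMatching F M)
    (r : IsRich F M e f u v u' v' p q a b c d) (hg : g ∈ M) (heg : e ≠ g) (hfg : f ≠ g) :
    crossCount F M e g + crossCount F M f g ≤ 13 := by
  have huv := r.crossDegree_le_two h hg heg hfg
  have hvu' := r.rotate.crossDegree_le_two h hg hfg heg
  have hu'_v' := r.rotate.rotate.crossDegree_le_two h hg heg hfg
  have hv'u := r.rotate.rotate.rotate.crossDegree_le_two h hg hfg heg
  have hpq := r.crossDegree_le_two_of_three_le h hg heg hfg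
  have hthree : ∀ w, crossDegree F M w g ≤ 3 := fun w ↦
    (crossDegree_le_card F M w g).trans_eq (h.card_eq_three hg)
  have := hthree u
  have := hthree v
  have := hthree u'
  have := hthree v'
  have := hthree p
  have := hthree q
  rw [r.crossCount_left, r.rotate.crossCount_left]
  lia

end IsRich

namespace IsMaxTripleMatching

/-- The case analysis only uses that tips at a common vertex differ and that no perfect matching
between the two members has three distinct tips. -/
lemma exists_isRich_of_isCrossEdge (h : IsMaxTripleMatching F M) (he : e ∈ M) (hf : f ∈ M)
    (hef : e ≠ f) {u₁ u₂ v₁ v₂ x₁₁ x₁₂ x₁₃ x₂₁ x₂₂ x₂₃ x₃₁ x₃₂ : V} (he' : e = {u₁, u₂, p})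
    (hf' : f = {v₁, v₂, q}) (hu : [u₁, u₂, p].Nodup) (hv : [v₁, v₂, q].Nodup)
    (h₁₁ : IsCrossEdge F M u₁ v₁ x₁₁) (h₁₂ : IsCrossEdge F M u₁ v₂ x₁₂)
    (h₁₃ : IsCrossEdge F M u₁ q x₁₃) (h₂₁ : IsCrossEdge F M u₂ v₁ x₂₁)
    (h₂₂ : IsCrossEdge F M u₂ v₂ x₂₂) (h₂₃ : IsCrossEdge F M u₂ q x₂₃)
    (h₃₁ : IsCrossEdge F M p v₁ x₃₁) (h₃₂ : IsCrossEdge F M p v₂ x₃₂) :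
    ∃ u v u' v' a b c d, IsRich F M e f u v u' v' p q a b c d := by
  have hthree {w₁ w₂ w₃ y₁ y₂ y₃ : V} (hw : [w₁, w₂, w₃].Nodup) (hwf : {w₁, w₂, w₃} ⊆ f) :=
    h.tip_eq_of_three (x₁ := y₁) (x₂ := y₂) (x₃ := y₃) he hf hef hu hw he'.ge hwf
  have m₁ := hthree (w₁ := v₁) (by grind) (by grind) h₁₁ h₂₃ h₃₂
  have m₂ := hthree (w₁ := q) (by grind) (by grind) h₁₃ h₂₂ h₃₁
  have m₃ := hthree (w₁ := v₂) (by grind) (by grind) h₁₂ h₂₃ h₃₁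
  have m₄ := hthree (w₁ := q) (by grind) (by grind) h₁₃ h₂₁ h₃₂
  obtain ⟨hu₁₂, hu₁₃, hu₂₃⟩ : u₁ ≠ u₂ ∧ u₁ ≠ p ∧ u₂ ≠ p := by grind
  obtain ⟨hv₁₂, hv₁₃, hv₂₃⟩ : v₁ ≠ v₂ ∧ v₁ ≠ q ∧ v₂ ≠ q := by grind
  have hpattern : (x₂₃ = x₁₁ ∧ x₃₁ = x₁₂ ∧ x₂₂ = x₁₃ ∧ x₃₂ = x₂₁) ∨
      (x₃₂ = x₁₁ ∧ x₁₃ = x₂₁ ∧ x₃₁ = x₂₂ ∧ x₂₃ = x₁₂) := by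
    have r₁ := h.tip_ne_of_isCrossEdge h₁₁ h₁₂ hv₁₂
    have r₂ := h.tip_ne_of_isCrossEdge h₁₁ h₁₃ hv₁₃
    have r₃ := h.tip_ne_of_isCrossEdge h₁₂ h₁₃ hv₂₃
    have r₄ := h.tip_ne_of_isCrossEdge h₂₁ h₂₂ hv₁₂
    have r₅ := h.tip_ne_of_isCrossEdge h₂₁ h₂₃ hv₁₃
    have r₆ := h.tip_ne_of_isCrossEdge h₂₂ h₂₃ hv₂₃
    have r₇ := h.tip_ne_of_isCrossEdge h₃₁ h₃₂ hv₁₂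
    have c₁ := h.tip_ne_of_isCrossEdge h₁₁.symm h₂₁.symm hu₁₂
    have c₂ := h.tip_ne_of_isCrossEdge h₁₁.symm h₃₁.symm hu₁₃
    have c₃ := h.tip_ne_of_isCrossEdge h₂₁.symm h₃₁.symm hu₂₃
    have c₄ := h.tip_ne_of_isCrossEdge h₁₂.symm h₂₂.symm hu₁₂
    have c₅ := h.tip_ne_of_isCrossEdge h₁₂.symm h₃₂.symm hu₁₃
    have c₆ := h.tip_ne_of_isCrossEdge h₂₂.symm h₃₂.symm hu₂₃
    have c₇ := h.tip_ne_of_isCrossEdge h₁₃.symm h₂₃.symm hu₁₂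
    clear * - m₁ m₂ m₃ m₄ r₁ r₂ r₃ r₄ r₅ r₆ r₇ c₁ c₂ c₃ c₄ c₅ c₆ c₇
    grind
  rcases hpattern with ⟨rfl, rfl, rfl, rfl⟩ | ⟨rfl, rfl, rfl, rfl⟩
  · exact ⟨u₁, v₁, u₂, v₂, _, _, _, _, he, hf, hef, he', hf', hu, hv,
      h₁₁, h₂₁.symm, h₂₂, h₁₂.symm, h₁₃, h₃₁.symm, h₂₃, h₃₂.symm⟩
  · exact ⟨u₂, v₁, u₁, v₂, _, _, _, _, he, hf, hef, he'.trans (insert_comm _ _ _), hf',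
      (List.Perm.swap _ _ _).nodup hu, hv,
      h₂₁, h₁₁.symm, h₁₂, h₂₂.symm, h₂₃, h₃₁.symm, h₁₃, h₃₂.symm⟩

lemma exists_isRich (h : IsMaxTripleMatching F M) (he : e ∈ M) (hf : f ∈ M) (hef : e ≠ f)
    (hcount : 8 ≤ crossCount F M e f) :
    ∃ u v u' v' p q a b c d, IsRich F M e f u v u' v' p q a b c d := by
  classical
  rw [crossCount_eq_card_filter_product] at hcount
  obtain ⟨D, hD, hD8⟩ := exists_subset_card_eq hcount
  have hDef : D ⊆ e ×ˢ f := hD.trans (filter_subset _ _)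
  obtain ⟨⟨p, q⟩, hpq⟩ := card_eq_one.1 (show (e ×ˢ f \ D).card = 1 by
    rw [card_sdiff_of_subset hDef, card_product, h.card_eq_three he, h.card_eq_three hf, hD8])
  have hcross : ∀ u ∈ e, ∀ v ∈ f, ¬(u = p ∧ v = q) → IsCrossPair F M u v := by
    intro u hu v hv huv
    have huvD : (u, v) ∈ D := by
      by_contra huvD
      have hmem := mem_sdiff.2 ⟨mem_product.2 ⟨hu, hv⟩, huvD⟩
      rw [hpq, mem_singleton, Prod.mk.injEq] at hmem
      exact huv hmem
    exact (mem_filter.1 (hD huvD)).2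
  have hmem : (p, q) ∈ e ×ˢ f := sdiff_subset (hpq ▸ mem_singleton_self (p, q))
  rw [mem_product] at hmem
  obtain ⟨u₁, u₂, hu, he'⟩ := exists_eq_insert_of_card_eq_three (h.card_eq_three he) hmem.1
  obtain ⟨v₁, v₂, hv, hf'⟩ := exists_eq_insert_of_card_eq_three (h.card_eq_three hf) hmem.2
  have hcross' : ∀ u ∈ ({u₁, u₂, p} : Finset V), ∀ v ∈ ({v₁, v₂, q} : Finset V),
      ¬(u = p ∧ v = q) → IsCrossPair F M u v := by rwa [← he', ← hf']
  obtain ⟨x₁₁, h₁₁⟩ := hcross' u₁ (by simp) v₁ (by simp) (by grind)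
  obtain ⟨x₁₂, h₁₂⟩ := hcross' u₁ (by simp) v₂ (by simp) (by grind)
  obtain ⟨x₁₃, h₁₃⟩ := hcross' u₁ (by simp) q (by simp) (by grind)
  obtain ⟨x₂₁, h₂₁⟩ := hcross' u₂ (by simp) v₁ (by simp) (by grind)
  obtain ⟨x₂₂, h₂₂⟩ := hcross' u₂ (by simp) v₂ (by simp) (by grind)
  obtain ⟨x₂₃, h₂₃⟩ := hcross' u₂ (by simp) q (by simp) (by grind)
  obtain ⟨x₃₁, h₃₁⟩ := hcross' p (by simp) v₁ (by simp) (by grind)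
  obtain ⟨x₃₂, h₃₂⟩ := hcross' p (by simp) v₂ (by simp) (by grind)
  obtain ⟨u, v, u', v', a, b, c, d, r⟩ :=
    h.exists_isRich_of_isCrossEdge he hf hef he' hf' hu hv h₁₁ h₁₂ h₁₃ h₂₁ h₂₂ h₂₃ h₃₁ h₃₂
  exact ⟨u, v, u', v', p, q, a, b, c, d, r⟩

lemma crossCount_le_eight (h : IsMaxTripleMatching F M) (he : e ∈ M) (hf : f ∈ M)
    (hef : e ≠ f) : crossCount F M e f ≤ 8 := by
  classical
  by_contra! hcount
  obtain ⟨u, v, u', v', p, q, a, b, c, d, r⟩ := h.exists_isRich he hf hef (by lia)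
  have hall : (e ×ˢ f).filter (fun t ↦ IsCrossPair F M t.1 t.2) = e ×ˢ f := by
    refine eq_of_subset_of_card_le (filter_subset _ _) ?_
    rwa [← crossCount_eq_card_filter_product, card_product, h.card_eq_three he,
      h.card_eq_three hf]
  obtain ⟨z, hz⟩ := (filter_eq_self.1 hall) (p, q) (by simp [r.left_eq, r.right_eq])
  have := h.tip_eq_of_three he hf hef r.left_nodup r.right_nodup r.left_eq.ge r.right_eq.ge
    r.u_v r.u'_v' hz
  have hvq := h.tip_ne_of_isCrossEdge r.u_v r.u_q (by have := r.right_nodup; grind)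
  have hup := h.tip_ne_of_isCrossEdge r.u'_q.symm hz.symm (by have := r.left_nodup; grind)
  have hup' := h.tip_ne_of_isCrossEdge r.u_q.symm hz.symm (by have := r.left_nodup; grind)
  tauto

lemma crossCount_triple_le (h : IsMaxTripleMatching F M) (he : e ∈ M) (hf : f ∈ M) (hg : g ∈ M)
    (hef : e ≠ f) (heg : e ≠ g) (hfg : f ≠ g) :
    crossCount F M e f + crossCount F M f g + crossCount F M e g ≤ 21 := by
  have hpair {e f g : Finset V} (he : e ∈ M) (hf : f ∈ M) (hg : g ∈ M) (hef : e ≠ f)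
      (heg : e ≠ g) (hfg : f ≠ g) (hcount : 8 ≤ crossCount F M e f) :
      crossCount F M e g + crossCount F M f g ≤ 13 := by
    obtain ⟨u, v, u', v', p, q, a, b, c, d, r⟩ := h.exists_isRich he hf hef hcount
    exact r.crossCount_add_le h hg heg hfg
  have hef8 := h.crossCount_le_eight he hf hef
  have heg8 := h.crossCount_le_eight he hg heg
  have hfg8 := h.crossCount_le_eight hf hg hfg
  have hef13 := hpair he hf hg hef heg hfg
  have heg13 := hpair he hg hf heg hef hfg.symm
  have hfg13 := hpair hf hg he hfg hef.symm heg.symm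
  rw [crossCount_comm F M g f] at heg13
  rw [crossCount_comm F M f e, crossCount_comm F M g e] at hfg13
  lia

lemma not_isCrossPair (h : IsMaxTripleMatching F M) (he : e ∈ M) (hu : u ∈ e) (hv : v ∈ e) :
    ¬IsCrossPair F M u v := by
  rintro ⟨x, hx⟩
  have heq := h.isLinear.eq_of_mem hx.mem (h.subset he) (h.ne_of_isCrossEdge hx) (by simp)
    (by simp) hu hv
  exact hx.tip_notMem (subset_vertices he (heq ▸ by simp))

lemma crossCount_self (h : IsMaxTripleMatching F M) (he : e ∈ M) : crossCount F M e e = 0 := by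
  classical
  exact sum_eq_zero fun u hu ↦ card_eq_zero.2 <|
    filter_eq_empty_iff.2 fun v hv ↦ h.not_isCrossPair he hu hv

end IsMaxTripleMatching

end RichPairs

section Counting

variable {V : Type*} [DecidableEq V] {F M B : Finset (Finset V)}

lemma sum_sum_le_of_triple_le {α : Type*} {s : Finset α} {t : α → α → ℕ} {K : ℕ}
    (ht : ∀ i ∈ s, ∀ j ∈ s, ∀ k ∈ s, t i j + t j k + t i k ≤ 3 * K) :
    ∑ i ∈ s, ∑ j ∈ s, t i j ≤ K * s.card ^ 2 := by
  rcases s.eq_empty_or_nonempty with rfl | hs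
  · simp
  have hij : ∑ i ∈ s, ∑ j ∈ s, ∑ _k ∈ s, t i j = s.card * ∑ i ∈ s, ∑ j ∈ s, t i j := by
    simp only [sum_const, smul_eq_mul, mul_sum]
  have hjk : ∑ _i ∈ s, ∑ j ∈ s, ∑ k ∈ s, t j k = s.card * ∑ i ∈ s, ∑ j ∈ s, t i j := by
    simp only [sum_const, smul_eq_mul]
  have hik : ∑ i ∈ s, ∑ _j ∈ s, ∑ k ∈ s, t i k = s.card * ∑ i ∈ s, ∑ j ∈ s, t i j := by
    simp only [sum_const, smul_eq_mul, mul_sum]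
  have hsum : ∑ i ∈ s, ∑ j ∈ s, ∑ k ∈ s, (t i j + t j k + t i k) ≤ s.card ^ 3 * (3 * K) := by
    refine (sum_le_sum fun i hi ↦ sum_le_sum fun j hj ↦ sum_le_sum (ht i hi j hj)).trans_eq ?_
    simp only [sum_const, smul_eq_mul]
    ring
  simp only [sum_add_distrib, hij, hjk, hik] at hsum
  have hpos : 0 < 3 * s.card := by
    have := card_pos.2 hs
    lia
  refine le_of_mul_le_mul_left ?_ hpos
  linarith

/-- The bounds 8 for pairs and 21 for triples average to 7, once every diagonal entry is given
weight 5. -/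
lemma IsMaxTripleMatching.sum_crossCount_le (h : IsMaxTripleMatching F M) (hB : B ⊆ M) :
    ∑ e ∈ B, ∑ f ∈ B, crossCount F M e f + 5 * B.card ≤ 7 * B.card ^ 2 := by
  have htriple : ∀ e ∈ B, ∀ f ∈ B, ∀ g ∈ B, (crossCount F M e f + if e = f then 5 else 0) +
      (crossCount F M f g + if f = g then 5 else 0) +
      (crossCount F M e g + if e = g then 5 else 0) ≤ 3 * 7 := by
    intro e he f hf g hg
    have hself : ∀ e ∈ B, crossCount F M e e = 0 := fun e he ↦ h.crossCount_self (hB he)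
    have height : ∀ e ∈ B, ∀ f ∈ B, e ≠ f → crossCount F M e f ≤ 8 :=
      fun e he f hf ↦ h.crossCount_le_eight (hB he) (hB hf)
    have htri := h.crossCount_triple_le (hB he) (hB hf) (hB hg)
    by_cases hef : e = f <;> by_cases hfg : f = g <;> by_cases heg : e = g <;> grind
  have := sum_sum_le_of_triple_le htriple
  simpa [sum_add_distrib, mul_comm] using this

end Counting

section Weights

variable {V : Type*} [DecidableEq V] {F M : Finset (Finset V)} {E e f : Finset V}
  {u v w b b' v' : V}

/-- The edges outside the matching that avoid the centres and have at least two matched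
vertices. -/
def heavyEdges (F M : Finset (Finset V)) : Finset (Finset V) :=
  F.filter fun E ↦ E ∉ M ∧ Disjoint E (centres F M) ∧ 1 < (E ∩ vertices M).card

/-- `{u, v, w}` is an edge with `u` and `w` in stars, `w` not a centre, and `v` matched outside
the stars. -/
structure IsMixedEdge (F M : Finset (Finset V)) (u v w : V) : Prop where
  left_mem : u ∈ vertices (stars F M)
  right_mem : v ∈ vertices (M \ stars F M)
  tip_mem : w ∈ vertices (stars F M)
  tip_notMem : w ∉ centres F M
  mem : {u, v, w} ∈ F

/-- A vertex `u` in a star and a matched vertex `v` outside the stars forming an edge together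
with a vertex in a star that is not a centre. -/
def IsMixedPair (F M : Finset (Finset V)) (u v : V) : Prop :=
  ∃ w, IsMixedEdge F M u v w

/-- A heavy edge distributes its weight over the charged pairs that it contains. -/
def IsCharged (F M : Finset (Finset V)) (u v : V) : Prop :=
  u ∈ vertices M ∧ v ∈ vertices (M \ stars F M) ∧ u ≠ v ∧ ∃ E ∈ heavyEdges F M, u ∈ E ∧ v ∈ E

open scoped Classical in
/-- The weight of an ordered pair, arranged so that every heavy edge contains pairs of total weight
at least 12. The factor 2 accounts for the pairs `(u, v)` with `u` in a star, which are charged in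
this order only. -/
noncomputable def weight (F M : Finset (Finset V)) (u v : V) : ℕ :=
  if IsCharged F M u v then
    (if u ∈ vertices (stars F M) then 2 else 1) *
      (if IsCrossPair F M u v then 6 else if IsMixedPair F M u v then 3 else 2)
  else 0

lemma mem_heavyEdges : E ∈ heavyEdges F M ↔
    E ∈ F ∧ E ∉ M ∧ Disjoint E (centres F M) ∧ 1 < (E ∩ vertices M).card := mem_filter

namespace IsMaxTripleMatching

lemma notMem_vertices_of_mem_stars (h : IsMaxTripleMatching F M)
    (hv : v ∈ vertices (M \ stars F M)) : v ∉ vertices (stars F M) := by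
  intro hvS
  obtain ⟨f, hf, hvf⟩ := mem_vertices.1 hv
  obtain ⟨e, he, hve⟩ := mem_vertices.1 hvS
  rw [mem_sdiff] at hf
  exact hf.2 (h.isMatching.eq_of_mem (stars_subset he) hf.1 hve hvf ▸ he)

lemma ne_of_isMixedEdge (h : IsMaxTripleMatching F M) (huv : IsMixedEdge F M u v w) : u ≠ w := by
  rintro rfl
  have := h.sized huv.mem
  rw [pair_comm, insert_idem] at this
  exact absurd (card_le_two (a := u) (b := v)) (by lia)

lemma notMem_of_isMixedEdge (h : IsMaxTripleMatching F M) (huv : IsMixedEdge F M u v w)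
    (he : e ∈ stars F M) (hu : u ∈ e) : w ∉ e := by
  intro hw
  have heq := h.isLinear.eq_of_mem huv.mem (h.subset (stars_subset he)) (h.ne_of_isMixedEdge huv)
    (by simp) (by simp) hu hw
  exact h.notMem_vertices_of_mem_stars huv.right_mem (subset_vertices he (heq ▸ by simp))

lemma not_isCrossPair_of_isMixedPair (h : IsMaxTripleMatching F M)
    (huv : IsMixedPair F M u v) : ¬IsCrossPair F M u v := by
  rintro ⟨x, hx⟩
  obtain ⟨w, hw⟩ := huv
  have heq := h.isLinear.eq_of_mem hw.mem hx.mem (h.ne_of_isCrossEdge hx) (by simp) (by simp)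
    (by simp) (by simp)
  have hwmem : w ∈ ({u, v, x} : Finset V) := heq ▸ by simp
  have hwu := h.ne_of_isMixedEdge hw
  have hwv : w ≠ v := fun hwv ↦ h.notMem_vertices_of_mem_stars hw.right_mem (hwv ▸ hw.tip_mem)
  have hwx : w ≠ x := fun hwx ↦ hx.tip_notMem (hwx ▸ vertices_mono stars_subset hw.tip_mem)
  grind

/-- Otherwise the mixed edge, the cross edge and pendant edges at the centres of the two stars
could replace the three members of the matching that are involved. -/
lemma not_isCrossPair_of_isMixedPair_of_ne (h : IsMaxTripleMatching F M) (he : e ∈ stars F M)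
    (hf : f ∈ M \ stars F M) (hb : b ∈ e \ centres F M) (hb' : b' ∈ e \ centres F M)
    (hbb' : b ≠ b') (hv : v ∈ f) (hv' : v' ∈ f) (hvv' : v ≠ v')
    (hbv : IsMixedPair F M b v) : ¬IsCrossPair F M b' v' := by
  rintro ⟨x, hx⟩
  obtain ⟨w, hw⟩ := hbv
  obtain ⟨e', he', hwe'⟩ := mem_vertices.1 hw.tip_mem
  obtain ⟨heM, c, hce, hc⟩ := mem_filter.1 he
  obtain ⟨heM', c', hce', hc'⟩ := mem_filter.1 he'
  obtain ⟨hfM, hfS⟩ := mem_sdiff.1 hf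
  rw [mem_sdiff] at hb hb'
  have hef : e ≠ f := by grind
  have hef' : e' ≠ f := by grind
  have hee' : e ≠ e' := by
    rintro rfl
    exact h.notMem_of_isMixedEdge hw he hb.1 hwe'
  have hdisj_ef : ∀ y ∈ e, ∀ z ∈ f, y ≠ z := fun _ hy _ ↦ h.isMatching.ne_of_mem heM hfM hef hy
  have hdisj_ef' : ∀ y ∈ e', ∀ z ∈ f, y ≠ z :=
    fun _ hy _ ↦ h.isMatching.ne_of_mem heM' hfM hef' hy
  have hdisj_ee' : ∀ y ∈ e, ∀ z ∈ e', y ≠ z :=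
    fun _ hy _ ↦ h.isMatching.ne_of_mem heM heM' hee' hy
  have hxM : ∀ y ∈ M, x ∉ y := fun y hy hxy ↦ hx.tip_notMem (subset_vertices hy hxy)
  have hwC := hw.tip_notMem
  have := h.length_add_card_le (R := {e, e', f}) (Q := [{b, v, w}, {b', v', x}]) (X := {x})
    (C := {c, c'}) (by grind) (by simpa using hx.tip_notMem) (by grind)
    (by simp [vertices]; grind) (by rw [card_pair (hdisj_ee' c hce c' hce')]; simp)
    (by simp; grind) (by simp [hw.mem, hx.mem, vertices, insert_subset_iff]; grind)
  rw [card_pair (hdisj_ee' c hce c' hce')] at this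
  simp only [List.length_cons, List.length_nil] at this
  have := card_le_three (a := e) (b := e') (c := f)
  lia

lemma crossDegree_add_le_four (h : IsMaxTripleMatching F M) (he : e ∈ stars F M) (hf : f ∈ M)
    (hef : e ≠ f) (hb : b ∈ e \ centres F M) (hb' : b' ∈ e \ centres F M) (hbb' : b ≠ b') :
    crossDegree F M b f + crossDegree F M b' f ≤ 4 := by
  have htwo {b b' : V} (hb : b ∈ e \ centres F M) (hb' : b' ∈ e \ centres F M) (hbb' : b ≠ b')
      (hpos : 0 < crossDegree F M b f) : crossDegree F M b' f ≤ 2 := by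
    obtain ⟨k, hk, x, -, hx⟩ := h.exists_tip_notMem ∅ (by rwa [card_empty])
    exact h.crossDegree_le_two f k x fun w hw hwk y hy ↦
      (h.tip_eq_of_mem_stars he hf hef hb hb' hbb' hk hw hwk.symm hx hy).symm
  have hf3 := h.card_eq_three hf
  have hle := crossDegree_le_card F M b f
  have hle' := crossDegree_le_card F M b' f
  have := htwo hb hb' hbb'
  have := htwo hb' hb hbb'.symm
  lia

lemma crossDegree_add_le_three (h : IsMaxTripleMatching F M) (he : e ∈ stars F M)
    (hf : f ∈ M \ stars F M) (hb : b ∈ e \ centres F M) (hb' : b' ∈ e \ centres F M)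
    (hbb' : b ≠ b') (hv : v ∈ f) (hbv : IsMixedPair F M b v) :
    crossDegree F M b f + crossDegree F M b' f ≤ 3 := by
  classical
  have hb2 : crossDegree F M b f ≤ (f.erase v).card := card_le_card fun y hy ↦ by
    rw [mem_filter] at hy
    exact mem_erase.2 ⟨fun hyv ↦ h.not_isCrossPair_of_isMixedPair hbv (hyv ▸ hy.2), hy.1⟩
  have hb1 : crossDegree F M b' f ≤ ({v} : Finset V).card := card_le_card fun y hy ↦ by
    rw [mem_filter] at hy
    refine mem_singleton.2 (by_contra fun hyv ↦ ?_)
    exact h.not_isCrossPair_of_isMixedPair_of_ne he hf hb hb' hbb' hv hy.1 (Ne.symm hyv) hbv hy.2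
  rw [card_erase_of_mem hv, h.card_eq_three (sdiff_subset hf)] at hb2
  rw [card_singleton] at hb1
  lia

end IsMaxTripleMatching

lemma mem_vertices_stars_or (hv : v ∈ vertices M) :
    v ∈ vertices (stars F M) ∨ v ∈ vertices (M \ stars F M) := by
  obtain ⟨A, hA, hvA⟩ := mem_vertices.1 hv
  by_cases hAS : A ∈ stars F M
  · exact .inl (subset_vertices hAS hvA)
  · exact .inr (subset_vertices (mem_sdiff.2 ⟨hA, hAS⟩) hvA)

lemma IsCharged.symm (huv : IsCharged F M u v) (hu : u ∈ vertices (M \ stars F M)) :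
    IsCharged F M v u :=
  let ⟨_, hv, hne, E, hE, huE, hvE⟩ := huv
  ⟨vertices_mono sdiff_subset hv, hu, hne.symm, E, hE, hvE, huE⟩

lemma six_le_weight (huv : IsCharged F M u v) (hmixed : IsMixedPair F M u v) :
    6 ≤ weight F M u v := by
  obtain ⟨w, hw⟩ := id hmixed
  rw [weight, if_pos huv, if_pos hw.left_mem, if_pos hmixed]
  split_ifs <;> lia

lemma sum_sum_triple_le (huvw : [u, v, w].Nodup) (t : V → V → ℕ) :
    (t u v + t v u) + (t u w + t w u) + (t v w + t w v) ≤
      ∑ a ∈ {u, v, w}, ∑ b ∈ {u, v, w}, t a b := by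
  obtain ⟨huv, huw, hvw⟩ : u ≠ v ∧ u ≠ w ∧ v ≠ w := by simpa [and_assoc] using huvw
  simp only [sum_insert, mem_insert, mem_singleton, huv, huw, hvw, or_self, not_false_eq_true,
    sum_singleton]
  lia

lemma weight_eq_zero (huv : ¬IsCharged F M u v) : weight F M u v = 0 := if_neg huv

namespace IsMaxTripleMatching

lemma not_isCharged (h : IsMaxTripleMatching F M) (he : e ∈ M) (hu : u ∈ e) (hv : v ∈ e) :
    ¬IsCharged F M u v := by
  rintro ⟨-, -, huv, E, hE, huE, hvE⟩
  rw [mem_heavyEdges] at hE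
  exact hE.2.1 (h.isLinear.eq_of_mem hE.1 (h.subset he) huv huE hvE hu hv ▸ he)

lemma twelve_le_weight_add_weight (h : IsMaxTripleMatching F M) (huv : IsCharged F M u v)
    (hcross : IsCrossPair F M u v) : 12 ≤ weight F M u v + weight F M v u := by
  rcases mem_vertices_stars_or huv.1 with hu | hu
  · rw [weight, if_pos huv, if_pos hu, if_pos hcross]
    lia
  · have hvS := h.notMem_vertices_of_mem_stars huv.2.1
    rw [weight, if_pos huv, if_neg (h.notMem_vertices_of_mem_stars hu), if_pos hcross, weight,
      if_pos (huv.symm hu), if_neg hvS, if_pos (isCrossPair_comm.1 hcross)]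

lemma four_le_weight_add_weight (h : IsMaxTripleMatching F M) (huv : IsCharged F M u v) :
    4 ≤ weight F M u v + weight F M v u := by
  rcases mem_vertices_stars_or huv.1 with hu | hu
  · rw [weight, if_pos huv, if_pos hu]
    split_ifs <;> lia
  · have hvS := h.notMem_vertices_of_mem_stars huv.2.1
    rw [weight, if_pos huv, if_neg (h.notMem_vertices_of_mem_stars hu), weight,
      if_pos (huv.symm hu), if_neg hvS]
    split_ifs <;> lia

/-- If `u` and `v` are in stars, then their pairs with `w` are mixed; otherwise all three pairs of
vertices are charged. -/
lemma twelve_le_of_mem_vertices (h : IsMaxTripleMatching F M) (huvw : [u, v, w].Nodup)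
    (hE : {u, v, w} ∈ heavyEdges F M) (hu : u ∈ vertices M) (hv : v ∈ vertices M)
    (hw : w ∈ vertices (M \ stars F M)) :
    12 ≤ (weight F M u v + weight F M v u) + (weight F M u w + weight F M w u) +
      (weight F M v w + weight F M w v) := by
  obtain ⟨hEF, -, hEC, -⟩ := mem_heavyEdges.1 hE
  obtain ⟨huv, huw, hvw⟩ : u ≠ v ∧ u ≠ w ∧ v ≠ w := by simpa [and_assoc] using huvw
  have huwc : IsCharged F M u w := ⟨hu, hw, huw, _, hE, by simp, by simp⟩
  have hvwc : IsCharged F M v w := ⟨hv, hw, hvw, _, hE, by simp, by simp⟩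
  have huw4 := h.four_le_weight_add_weight huwc
  have hvw4 := h.four_le_weight_add_weight hvwc
  rcases mem_vertices_stars_or hu with huS | huB
  · rcases mem_vertices_stars_or hv with hvS | hvB
    · have := six_le_weight huwc ⟨v, huS, hw, hvS, fun hvC ↦ disjoint_left.1 hEC (by simp) hvC,
        by rwa [pair_comm]⟩
      have := six_le_weight hvwc ⟨u, hvS, hw, huS, fun huC ↦ disjoint_left.1 hEC (by simp) huC,
        by rwa [pair_comm, insert_comm]⟩
      lia
    · have := h.four_le_weight_add_weight
        (⟨hu, hvB, huv, _, hE, by simp, by simp⟩ : IsCharged F M u v)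
      lia
  · have := h.four_le_weight_add_weight
      (⟨hv, huB, huv.symm, _, hE, by simp, by simp⟩ : IsCharged F M v u)
    lia

lemma twelve_le_sum_weight (h : IsMaxTripleMatching F M) (hE : E ∈ heavyEdges F M) :
    12 ≤ ∑ u ∈ E, ∑ v ∈ E, weight F M u v := by
  obtain ⟨hEF, -, hEC, hE2⟩ := mem_heavyEdges.1 hE
  obtain ⟨w, hwE, hw⟩ := not_disjoint_iff.1 (h.not_disjoint_vertices_sdiff_stars hEF hEC)
  obtain ⟨u, v, huvw, rfl⟩ := exists_eq_insert_of_card_eq_three (h.sized hEF) hwE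
  obtain ⟨-, huw, hvw⟩ : u ≠ v ∧ u ≠ w ∧ v ≠ w := by simpa [and_assoc] using huvw
  have hwM := vertices_mono sdiff_subset hw
  refine le_trans ?_ (sum_sum_triple_le huvw (weight F M))
  by_cases hu : u ∈ vertices M <;> by_cases hv : v ∈ vertices M
  · exact h.twelve_le_of_mem_vertices huvw hE hu hv hw
  · have := h.twelve_le_weight_add_weight (u := u) (v := w)
      ⟨hu, hw, huw, _, hE, by simp, by simp⟩ ⟨v, hu, hwM, hv, by rwa [pair_comm]⟩
    lia
  · have := h.twelve_le_weight_add_weight (u := v) (v := w)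
      ⟨hv, hw, hvw, _, hE, by simp, by simp⟩
      ⟨u, hv, hwM, hu, by rwa [pair_comm, insert_comm]⟩
    lia
  · rw [insert_inter_of_notMem hu, insert_inter_of_notMem hv] at hE2
    exact absurd hE2 ((card_le_card inter_subset_left).trans_eq (card_singleton w)).not_gt

lemma sum_heavyEdges_le (h : IsMaxTripleMatching F M) :
    ∑ E ∈ heavyEdges F M, ∑ u ∈ E, ∑ v ∈ E, weight F M u v ≤
      ∑ u ∈ vertices M, ∑ v ∈ vertices (M \ stars F M), weight F M u v := by
  classical
  have hfilter : ∀ E ∈ heavyEdges F M, ∑ u ∈ E, ∑ v ∈ E, weight F M u v =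
      ∑ t ∈ (E ×ˢ E).filter fun t ↦ IsCharged F M t.1 t.2, weight F M t.1 t.2 := fun E _ ↦ by
    rw [← sum_product', sum_filter_of_ne fun t _ ht ↦ not_not.1 fun hct ↦ ht (weight_eq_zero hct)]
  rw [sum_congr rfl hfilter, ← sum_biUnion, ← sum_product']
  · refine sum_le_sum_of_subset (biUnion_subset.2 fun E _ t ht ↦ ?_)
    obtain ⟨-, ht₁, ht₂, -⟩ := mem_filter.1 ht
    exact mem_product.2 ⟨ht₁, ht₂⟩
  · refine fun E hE E' hE' hEE' ↦ disjoint_left.2 fun t ht ht' ↦ hEE' ?_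
    simp only [mem_filter, mem_product] at ht ht'
    exact h.isLinear.eq_of_mem (mem_heavyEdges.1 hE).1 (mem_heavyEdges.1 hE').1 ht.2.2.2.1
      ht.1.1 ht.1.2 ht'.1.1 ht'.1.2

lemma sum_weight_add_le (h : IsMaxTripleMatching F M) (he : e ∈ M \ stars F M)
    (hf : f ∈ M) : ∑ u ∈ e, ∑ v ∈ f, weight F M u v ≤ 18 + 4 * crossCount F M e f := by
  classical
  have heS : ∀ u ∈ e, u ∉ vertices (stars F M) := fun u hu ↦
    h.notMem_vertices_of_mem_stars (subset_vertices he hu)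
  have hweight : ∀ u ∈ e, ∀ v ∈ f, weight F M u v ≤
      2 + 4 * if IsCrossPair F M u v then 1 else 0 := by
    intro u hu v _
    have hmixed : ¬IsMixedPair F M u v := fun ⟨_, hw⟩ ↦ heS u hu hw.left_mem
    rw [weight, if_neg (heS u hu), if_neg hmixed]
    split_ifs <;> simp
  refine (sum_le_sum fun u hu ↦ sum_le_sum (hweight u hu)).trans_eq ?_
  simp only [sum_add_distrib, sum_const, ← mul_sum, crossCount, crossDegree, card_filter,
    smul_eq_mul, h.card_eq_three hf, h.card_eq_three (sdiff_subset he)]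

lemma sum_weight_eq_zero (h : IsMaxTripleMatching F M) (he : e ∈ M) :
    ∑ u ∈ e, ∑ v ∈ e, weight F M u v = 0 :=
  sum_eq_zero fun _ hu ↦ sum_eq_zero fun _ hv ↦ weight_eq_zero (h.not_isCharged he hu hv)

end IsMaxTripleMatching

lemma weight_eq_zero_of_mem_centres (hu : u ∈ centres F M) : weight F M u v = 0 :=
  weight_eq_zero fun ⟨_, _, _, _, hE, huE, _⟩ ↦
    disjoint_left.1 (mem_heavyEdges.1 hE).2.2.1 huE hu

lemma sum_weight_le_of_forall_not (f : Finset V) (hmixed : ∀ v ∈ f, ¬IsMixedPair F M u v) :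
    ∑ v ∈ f, weight F M u v ≤ 4 * f.card + 8 * crossDegree F M u f := by
  classical
  have hweight : ∀ v ∈ f, weight F M u v ≤ 4 + 8 * if IsCrossPair F M u v then 1 else 0 := by
    intro v hv
    rw [weight, if_neg (hmixed v hv)]
    split_ifs <;> simp
  refine (sum_le_sum hweight).trans_eq ?_
  simp only [sum_add_distrib, sum_const, ← mul_sum, crossDegree, card_filter, smul_eq_mul,
    mul_comm]

lemma sum_weight_le (F M : Finset (Finset V)) (u : V) (f : Finset V) :
    ∑ v ∈ f, weight F M u v ≤ 6 * f.card + 6 * crossDegree F M u f := by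
  classical
  have hweight : ∀ v ∈ f, weight F M u v ≤ 6 + 6 * if IsCrossPair F M u v then 1 else 0 := by
    intro v _
    rw [weight]
    split_ifs <;> simp
  refine (sum_le_sum hweight).trans_eq ?_
  simp only [sum_add_distrib, sum_const, ← mul_sum, crossDegree, card_filter, smul_eq_mul,
    mul_comm]

namespace IsMaxTripleMatching

lemma sum_weight_le_of_mem_stars (h : IsMaxTripleMatching F M) (he : e ∈ stars F M)
    (hf : f ∈ M \ stars F M) : ∑ u ∈ e, ∑ v ∈ f, weight F M u v ≤ 56 := by
  have hfM := sdiff_subset hf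
  have hef : e ≠ f := fun hef ↦ (mem_sdiff.1 hf).2 (hef ▸ he)
  obtain ⟨heM, c, hce, hc⟩ := mem_filter.1 he
  obtain ⟨b, b', hbb'c, rfl⟩ := exists_eq_insert_of_card_eq_three (h.card_eq_three heM) hce
  obtain ⟨hbb', hbc, hbc'⟩ : b ≠ b' ∧ b ≠ c ∧ b' ≠ c := by grind
  have hb : b ∈ {b, b', c} \ centres F M := mem_sdiff.2
    ⟨by simp, fun hb ↦ hbc (h.eq_of_mem_centres heM (by simp) hb hce hc)⟩
  have hb' : b' ∈ {b, b', c} \ centres F M := mem_sdiff.2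
    ⟨by simp, fun hb ↦ hbc' (h.eq_of_mem_centres heM (by simp) hb hce hc)⟩
  rw [sum_insert (by simp [hbb', hbc]), sum_pair hbc',
    sum_eq_zero fun v _ ↦ weight_eq_zero_of_mem_centres hc, add_zero]
  have hf3 := h.card_eq_three hfM
  by_cases hmixed : ∃ v ∈ f, IsMixedPair F M b v ∨ IsMixedPair F M b' v
  · obtain ⟨v, hv, hbv⟩ := hmixed
    have hdeg : crossDegree F M b f + crossDegree F M b' f ≤ 3 := by
      rcases hbv with hbv | hbv
      · exact h.crossDegree_add_le_three he hf hb hb' hbb' hv hbv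
      · exact (add_comm _ _).trans_le
          (h.crossDegree_add_le_three he hf hb' hb hbb'.symm hv hbv)
    have := sum_weight_le F M b f
    have := sum_weight_le F M b' f
    lia
  · push Not at hmixed
    have hdeg := h.crossDegree_add_le_four he hfM hef hb hb' hbb'
    have := sum_weight_le_of_forall_not f fun v hv ↦ (hmixed v hv).1
    have := sum_weight_le_of_forall_not f fun v hv ↦ (hmixed v hv).2
    lia

lemma card_heavyEdges_le (h : IsMaxTripleMatching F M) :
    12 * (heavyEdges F M).card + 38 * (M \ stars F M).card ≤
      46 * (M \ stars F M).card ^ 2 + 56 * ((stars F M).card * (M \ stars F M).card) := by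
  set B := M \ stars F M
  have hB : IsMatching B := h.isMatching.mono sdiff_subset
  have hheavy : 12 * (heavyEdges F M).card ≤
      ∑ e ∈ M, ∑ f ∈ B, ∑ u ∈ e, ∑ v ∈ f, weight F M u v := by
    have hblocks : ∑ u ∈ vertices M, ∑ v ∈ vertices B, weight F M u v =
        ∑ e ∈ M, ∑ f ∈ B, ∑ u ∈ e, ∑ v ∈ f, weight F M u v := by
      rw [h.isMatching.sum_vertices]
      refine sum_congr rfl fun e _ ↦ ?_
      simp only [hB.sum_vertices]
      exact sum_comm
    rw [mul_comm, ← smul_eq_mul, ← hblocks]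
    exact (card_nsmul_le_sum _ _ _ fun E hE ↦ h.twelve_le_sum_weight hE).trans h.sum_heavyEdges_le
  have hstars : ∑ e ∈ stars F M, ∑ f ∈ B, ∑ u ∈ e, ∑ v ∈ f, weight F M u v ≤
      56 * ((stars F M).card * B.card) := by
    refine (sum_le_sum fun e he ↦ sum_le_sum fun f hf ↦
      h.sum_weight_le_of_mem_stars he hf).trans_eq ?_
    simp only [sum_const, smul_eq_mul]
    ring
  have hothers : ∑ e ∈ B, ∑ f ∈ B, ∑ u ∈ e, ∑ v ∈ f, weight F M u v + 18 * B.card ≤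
      18 * B.card ^ 2 + 4 * ∑ e ∈ B, ∑ f ∈ B, crossCount F M e f := by
    have hblock : ∀ e ∈ B, ∀ f ∈ B, ∑ u ∈ e, ∑ v ∈ f, weight F M u v + (if e = f then 18 else 0) ≤
        18 + 4 * crossCount F M e f := by
      intro e he f hf
      split_ifs with hef
      · subst hef
        rw [h.sum_weight_eq_zero (sdiff_subset he)]
        lia
      · exact h.sum_weight_add_le he (sdiff_subset hf)
    have := sum_le_sum fun e he ↦ sum_le_sum (hblock e he)
    simp only [sum_add_distrib, sum_ite_eq, sum_ite_mem, inter_self, sum_const, smul_eq_mul,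
      ← mul_sum] at this
    lia
  have hcross := h.sum_crossCount_le (B := B) sdiff_subset
  rw [← sum_sdiff (stars_subset (F := F))] at hheavy
  lia

end IsMaxTripleMatching

end Weights

section Bound

variable {V : Type*} [DecidableEq V] {F M : Finset (Finset V)} {E : Finset V} {x : V} {k D : ℕ}

namespace IsMaxTripleMatching

lemma card_filter_disjoint_centres_le (h : IsMaxTripleMatching F M) :
    (F.filter fun E ↦ Disjoint E (centres F M)).card ≤
      7 * (M \ stars F M).card + (heavyEdges F M).card := by
  set B := M \ stars F M
  set P := B.biUnion fun A ↦ A.biUnion (pendants F M)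
  have hcover : F.filter (fun E ↦ Disjoint E (centres F M)) ⊆ B ∪ P ∪ heavyEdges F M := by
    intro E hE
    obtain ⟨hEF, hEC⟩ := mem_filter.1 hE
    obtain ⟨v, hvE, hvB⟩ := not_disjoint_iff.1 (h.not_disjoint_vertices_sdiff_stars hEF hEC)
    rw [mem_union, mem_union]
    by_cases hEM : E ∈ M
    · refine .inl (.inl (mem_sdiff.2 ⟨hEM, fun hES ↦ ?_⟩))
      obtain ⟨-, c, hcE, hc⟩ := mem_filter.1 hES
      exact disjoint_left.1 hEC hcE hc
    by_cases hE1 : 1 < (E ∩ vertices M).card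
    · exact .inr (mem_heavyEdges.2 ⟨hEF, hEM, hEC, hE1⟩)
    obtain ⟨A, hA, hvA⟩ := mem_vertices.1 hvB
    have hvEM : v ∈ E ∩ vertices M := mem_inter.2 ⟨hvE, vertices_mono sdiff_subset hvB⟩
    have hEv : {v} = E ∩ vertices M :=
      eq_of_subset_of_card_le (singleton_subset_iff.2 hvEM) (by simpa using hE1)
    exact .inl (.inr (mem_biUnion.2
      ⟨A, hA, mem_biUnion.2 ⟨v, hvA, mem_pendants.2 ⟨hEF, hEv.symm⟩⟩⟩))
  have hP : P.card ≤ B.card * 6 := card_biUnion_le_card_mul _ _ _ fun A hA ↦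
    card_biUnion_le.trans (h.sum_card_pendants_le hA)
  have := card_le_card hcover
  have := card_union_le (B ∪ P) (heavyEdges F M)
  have := card_union_le B P
  lia

lemma card_le (h : IsMaxTripleMatching F M) (hdeg : ∀ x, degree F x ≤ 3 * M.card) :
    6 * F.card ≤ 23 * (M.card * (M.card + 1)) := by
  have hcentres : (F.filter fun E ↦ ¬Disjoint E (centres F M)).card ≤
      (stars F M).card * (3 * M.card) := by
    rw [← h.card_centres]
    refine (card_le_card fun E hE ↦ ?_).trans
      (card_biUnion_le_card_mul (centres F M) (fun c ↦ F.filter (c ∈ ·)) _ fun c _ ↦ hdeg c)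
    obtain ⟨hEF, hEC⟩ := mem_filter.1 hE
    obtain ⟨c, hcE, hc⟩ := not_disjoint_iff.1 hEC
    exact mem_biUnion.2 ⟨c, hc, mem_filter.2 ⟨hEF, hcE⟩⟩
  have hothers := h.card_filter_disjoint_centres_le
  have hheavy := h.card_heavyEdges_le
  have hsplit := card_filter_add_card_filter_not (s := F) fun E ↦ Disjoint E (centres F M)
  have hM : M.card = (M \ stars F M).card + (stars F M).card :=
    (card_sdiff_add_card_eq_card stars_subset).symm
  rw [hM] at hcentres ⊢
  nlinarith

end IsMaxTripleMatching

lemma card_le_of_degree_le (hF : (F : Set (Finset V)).Sized 3) (hL : IsLinear F)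
    (hdeg : ∀ x, degree F x ≤ 3 * matchingNumber F) :
    6 * F.card ≤ 23 * (matchingNumber F * (matchingNumber F + 1)) := by
  obtain ⟨M, hM⟩ := exists_isMaxMatching F
  rw [← hM.card_eq] at hdeg ⊢
  exact IsMaxTripleMatching.card_le ⟨hM, hF, hL⟩ hdeg

lemma IsMatching.insert (hM : IsMatching M) (hE : Disjoint E (vertices M)) :
    IsMatching (insert E M) := by
  have hEA : ∀ A ∈ M, Disjoint E A := fun A hA ↦ hE.mono_right (subset_vertices hA)
  intro A hA B hB hAB
  rcases mem_insert.1 hA with hAE | hAM <;> rcases mem_insert.1 hB with hBE | hBM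
  · exact absurd (hAE.trans hBE.symm) hAB
  · exact hAE ▸ hEA B hBM
  · exact hBE ▸ (hEA A hAM).symm
  · exact hM A hAM B hBM hAB

lemma degree_add_card_filter_notMem (F : Finset (Finset V)) (x : V) :
    degree F x + (F.filter (x ∉ ·)).card = F.card :=
  card_filter_add_card_filter_not _

lemma matchingNumber_filter_notMem_lt (hF : (F : Set (Finset V)).Sized k) (hL : IsLinear F)
    (hx : k * matchingNumber F < degree F x) :
    matchingNumber (F.filter (x ∉ ·)) < matchingNumber F := by
  obtain ⟨M, hM⟩ := exists_isMaxMatching (F.filter (x ∉ ·))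
  have hMF : M ⊆ F := hM.subset.trans (filter_subset _ _)
  have hle := hM.isMatching.card_le_matchingNumber hMF
  have hxM : x ∉ vertices M := fun hxM ↦ by
    obtain ⟨A, hA, hxA⟩ := mem_vertices.1 hxM
    exact (mem_filter.1 (hM.subset hA)).2 hxA
  have hcard : (vertices M).card ≤ M.card * k :=
    card_biUnion_le_card_mul _ _ _ fun A hA ↦ (hF (hMF hA)).le
  obtain ⟨E, hE, hEM⟩ := (hL.mono (filter_subset (x ∈ ·) F)).exists_disjoint
    (fun E hE ↦ (mem_filter.1 hE).2) hxM (hcard.trans_lt (by rw [degree] at hx; nlinarith))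
  obtain ⟨hEF, hxE⟩ := mem_filter.1 hE
  have := (hM.isMatching.insert hEM).card_le_matchingNumber (insert_subset hEF hMF)
  rw [card_insert_of_notMem fun hEM ↦ hxM (subset_vertices hEM hxE), hM.card_eq] at this
  lia

/-- Vertices of degree more than three times the matching number are deleted until none is left. -/
lemma card_le_mul_of_degree_le (hF : (F : Set (Finset V)).Sized 3) (hL : IsLinear F)
    (hdeg : ∀ x, degree F x ≤ D) (hD : 23 * (matchingNumber F + 1) ≤ 6 * D) :
    F.card ≤ D * matchingNumber F := by
  induction hn : matchingNumber F using Nat.strong_induction_on generalizing F with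
  | _ n ih =>
    subst hn
    by_cases hlarge : ∃ x, 3 * matchingNumber F < degree F x
    · obtain ⟨x, hx⟩ := hlarge
      have hlt := matchingNumber_filter_notMem_lt hF hL hx
      have hsub : F.filter (x ∉ ·) ⊆ F := filter_subset _ _
      have := ih _ hlt (hF.mono (coe_subset.2 hsub)) (hL.mono hsub)
        (fun y ↦ (card_le_card (filter_subset_filter _ hsub)).trans (hdeg y)) (by lia) rfl
      have := degree_add_card_filter_notMem F x
      have := hdeg x
      nlinarith
    · push Not at hlarge
      have := card_le_of_degree_le hF hL hlarge
      nlinarith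

lemma card_le_maxDegree_mul_matchingNumber (hF : (F : Set (Finset V)).Sized 3)
    (hL : IsLinear F) (hD : 23 * matchingNumber F ≤ 6 * maxDegree F) :
    F.card ≤ maxDegree F * matchingNumber F := by
  by_cases hlarge : ∃ x, 3 * matchingNumber F < degree F x
  · obtain ⟨x, hx⟩ := hlarge
    have hlt := matchingNumber_filter_notMem_lt hF hL hx
    have hsub : F.filter (x ∉ ·) ⊆ F := filter_subset _ _
    have := card_le_mul_of_degree_le (hF.mono (coe_subset.2 hsub)) (hL.mono hsub)
      (fun y ↦ (card_le_card (filter_subset_filter _ hsub)).trans (degree_le_maxDegree F y))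
      (by lia)
    have := degree_add_card_filter_notMem F x
    have := degree_le_maxDegree F x
    nlinarith
  · push Not at hlarge
    have hmax : maxDegree F ≤ 3 * matchingNumber F := Finset.sup_le fun x _ ↦ hlarge x
    have hzero : matchingNumber F = 0 := by lia
    have := card_le_of_degree_le hF hL hlarge
    rw [hzero] at this
    lia

end Bound

section DisjointUnion

variable {V ι : Type*} [DecidableEq V] {G : ι → Finset (Finset V)} {i : ι} {x : V}

lemma pairwise_disjoint_of_vertices
    (hG : Pairwise fun i j ↦ Disjoint (vertices (G i)) (vertices (G j))) (hne : ∀ i, ∅ ∉ G i) :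
    Pairwise fun i j ↦ Disjoint (G i) (G j) := by
  refine fun i j hij ↦ disjoint_left.2 fun A hAi hAj ↦ hne i ?_
  have hA : A = ∅ :=
    disjoint_self.1 ((hG hij).mono (subset_vertices hAi) (subset_vertices hAj))
  exact hA ▸ hAi

variable [Fintype ι]

lemma filter_mem_biUnion (hG : Pairwise fun i j ↦ Disjoint (vertices (G i)) (vertices (G j)))
    (hx : x ∈ vertices (G i)) : (univ.biUnion G).filter (x ∈ ·) = (G i).filter (x ∈ ·) := by
  refine subset_antisymm (fun A hA ↦ ?_) (filter_subset_filter _ (subset_biUnion_of_mem G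
    (mem_univ i)))
  obtain ⟨hA, hxA⟩ := mem_filter.1 hA
  obtain ⟨j, -, hAj⟩ := mem_biUnion.1 hA
  obtain rfl : j = i := hG.eq (not_disjoint_iff.2 ⟨x, subset_vertices hAj hxA, hx⟩)
  exact mem_filter.2 ⟨hAj, hxA⟩

lemma IsLinear.biUnion (hlin : ∀ i, IsLinear (G i))
    (hG : Pairwise fun i j ↦ Disjoint (vertices (G i)) (vertices (G j))) :
    IsLinear (univ.biUnion G) := by
  intro A hA B hB hAB
  obtain ⟨i, -, hAi⟩ := mem_biUnion.1 hA
  obtain ⟨j, -, hBj⟩ := mem_biUnion.1 hB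
  rcases eq_or_ne i j with rfl | hij
  · exact hlin i A hAi B hBj hAB
  · have := (hG hij).mono (subset_vertices hAi) (subset_vertices hBj)
    rw [disjoint_iff_inter_eq_empty.1 this, card_empty]
    exact Nat.zero_le 1

lemma maxDegree_biUnion (hG : Pairwise fun i j ↦ Disjoint (vertices (G i)) (vertices (G j))) :
    maxDegree (univ.biUnion G) = univ.sup fun i ↦ maxDegree (G i) := by
  have hvertices : vertices (univ.biUnion G) = univ.biUnion fun i ↦ vertices (G i) :=
    biUnion_biUnion _ _ _
  rw [maxDegree, hvertices, sup_biUnion]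
  refine sup_congr rfl fun i _ ↦ sup_congr rfl fun x hx ↦ ?_
  rw [degree, filter_mem_biUnion hG hx, degree]

lemma matchingNumber_biUnion
    (hG : Pairwise fun i j ↦ Disjoint (vertices (G i)) (vertices (G j))) (hne : ∀ i, ∅ ∉ G i) :
    matchingNumber (univ.biUnion G) = ∑ i, matchingNumber (G i) := by
  have hdisj := pairwise_disjoint_of_vertices hG hne
  refine le_antisymm (matchingNumber_le fun M hMG hM ↦ ?_) ?_
  · have hcover : M = univ.biUnion fun i ↦ M ∩ G i := by
      rw [← inter_biUnion, inter_eq_left.2 hMG]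
    rw [hcover]
    exact card_biUnion_le.trans (sum_le_sum fun i _ ↦
      (hM.mono inter_subset_left).card_le_matchingNumber inter_subset_right)
  · choose M hM using fun i ↦ exists_isMaxMatching (G i)
    have hmatching : IsMatching (univ.biUnion M) := by
      intro A hA B hB hAB
      obtain ⟨i, -, hAi⟩ := mem_biUnion.1 hA
      obtain ⟨j, -, hBj⟩ := mem_biUnion.1 hB
      rcases eq_or_ne i j with rfl | hij
      · exact (hM i).isMatching A hAi B hBj hAB
      · exact (hG hij).mono (subset_vertices ((hM i).subset hAi))
          (subset_vertices ((hM j).subset hBj))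
    have := hmatching.card_le_matchingNumber (biUnion_mono fun i _ ↦ (hM i).subset)
    rwa [card_biUnion fun i _ j _ hij ↦ (hdisj hij).mono (hM i).subset (hM j).subset,
      sum_congr rfl fun i _ ↦ (hM i).card_eq] at this

end DisjointUnion

section Sunflowers

variable {V : Type*} [DecidableEq V] {F G : Finset (Finset V)} {X : Finset V} {n d : ℕ}

lemma IsSunflower.isLinear (hG : IsSunflower G X) (hX : X.card ≤ 1) : IsLinear G :=
  fun A hA B hB hAB ↦ (hG.2 A hA B hB hAB).symm ▸ hX

lemma IsSunflower.matchingNumber_eq_one (hG : IsSunflower G X) (hX : X.Nonempty)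
    (hne : G.Nonempty) : matchingNumber G = 1 := by
  obtain ⟨x, hx⟩ := hX
  refine le_antisymm (matchingNumber_le fun M hM hMm ↦ card_le_one.2 fun A hA B hB ↦ ?_) ?_
  · exact hMm.eq_of_mem hA hB (hG.1 A (hM hA) hx) (hG.1 B (hM hB) hx)
  · obtain ⟨A, hA⟩ := hne
    exact IsMatching.card_le_matchingNumber (M := {A}) (by simp [IsMatching])
      (singleton_subset_iff.2 hA)

lemma IsSunflower.maxDegree_eq_card (hG : IsSunflower G X) (hX : X.Nonempty) :
    maxDegree G = G.card := by
  obtain ⟨x, hx⟩ := hX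
  refine le_antisymm (Finset.sup_le fun _ _ ↦ card_filter_le _ _) ?_
  have hdegree : degree G x = G.card := by
    rw [degree, filter_true_of_mem fun A hA ↦ hG.1 A hA hx]
  exact hdegree ▸ degree_le_maxDegree G x

theorem IsDisjointSunflowers.extremal (hF : IsDisjointSunflowers F n d) (hn : 0 < n)
    (hd : 0 < d) : (F : Set (Finset V)).Sized 3 ∧ IsLinear F ∧ matchingNumber F = n ∧
      maxDegree F = d ∧ F.card = d * n := by
  obtain ⟨G, rfl, hG, hdisj⟩ := hF
  choose hsized hcard c hsun using hG
  replace hdisj : Pairwise fun i j ↦ Disjoint (vertices (G i)) (vertices (G j)) := hdisj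
  have hempty : ∀ i, ∅ ∉ G i := fun i hi ↦ by simpa using hsized i hi
  have hnonempty : ∀ i, (G i).Nonempty := fun i ↦ card_pos.1 ((hcard i).symm ▸ hd)
  have : Nonempty (Fin n) := ⟨⟨0, hn⟩⟩
  refine ⟨fun A hA ↦ ?_, .biUnion (fun i ↦ (hsun i).isLinear (card_singleton _).le) hdisj,
    ?_, ?_, ?_⟩
  · obtain ⟨i, -, hAi⟩ := mem_biUnion.1 hA
    exact hsized i hAi
  · simp [matchingNumber_biUnion hdisj hempty,
      fun i ↦ (hsun i).matchingNumber_eq_one (singleton_nonempty _) (hnonempty i)]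
  · simp [maxDegree_biUnion hdisj, fun i ↦ (hsun i).maxDegree_eq_card (singleton_nonempty _),
      hcard, sup_const univ_nonempty]
  · rw [card_biUnion fun i _ j _ hij ↦ pairwise_disjoint_of_vertices hdisj hempty hij]
    simp [hcard, mul_comm]

/-- The `j`-th petal of the `i`-th sunflower in a standard family of disjoint sunflowers on `ℕ`,
where the pairing function keeps different sunflowers apart. -/
def petal (i j : ℕ) : Finset ℕ :=
  {Nat.pair i 0, Nat.pair i (2 * j + 1), Nat.pair i (2 * j + 2)}

lemma card_petal (i j : ℕ) : (petal i j).card = 3 :=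
  card_eq_three.2 ⟨_, _, _, by simp, by simp, by simp, rfl⟩

lemma petal_inter_petal {j k : ℕ} (i : ℕ) (hjk : j ≠ k) :
    petal i j ∩ petal i k = {Nat.pair i 0} := by
  ext x
  simp only [petal, mem_inter, mem_insert, mem_singleton]
  constructor
  · rintro ⟨rfl | rfl | rfl, h⟩ <;> simp only [Nat.pair_eq_pair] at h ⊢ <;> lia
  · rintro rfl
    simp

lemma petal_injective (i : ℕ) : Function.Injective (petal i) := by
  intro j k hjk
  by_contra hne
  have hcore := petal_inter_petal i hne
  rw [← hjk, inter_self] at hcore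
  have := card_petal i j
  simp [hcore] at this

lemma unpair_fst_of_mem_petal {i j x : ℕ} (hx : x ∈ petal i j) : x.unpair.1 = i := by
  simp only [petal, mem_insert, mem_singleton] at hx
  rcases hx with rfl | rfl | rfl <;> simp

theorem exists_isDisjointSunflowers (n d : ℕ) :
    ∃ F : Finset (Finset ℕ), IsDisjointSunflowers F n d := by
  have hmem {i x : ℕ} (hx : x ∈ vertices ((range d).image (petal i))) : x.unpair.1 = i := by
    obtain ⟨A, hA, hxA⟩ := mem_vertices.1 hx
    obtain ⟨j, -, rfl⟩ := mem_image.1 hA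
    exact unpair_fst_of_mem_petal hxA
  refine ⟨_, fun i : Fin n ↦ (range d).image (petal i), rfl, fun i ↦ ⟨?_, ?_, Nat.pair i 0, ?_, ?_⟩,
    fun i j hij ↦ disjoint_left.2 fun x hxi hxj ↦ hij (Fin.ext ((hmem hxi).symm.trans (hmem hxj)))⟩
  · intro A hA
    obtain ⟨j, -, rfl⟩ := mem_image.1 hA
    exact card_petal i j
  · rw [card_image_of_injective _ (petal_injective i), card_range]
  · intro A hA
    obtain ⟨j, -, rfl⟩ := mem_image.1 hA
    simp [petal]
  · intro A hA B hB hAB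
    obtain ⟨j, -, rfl⟩ := mem_image.1 hA
    obtain ⟨k, -, rfl⟩ := mem_image.1 hB
    exact petal_inter_petal i fun hjk ↦ hAB (hjk ▸ rfl)

end Sunflowers

/-- At `n = 1` the fraction is `1 / 0 = 0`. -/
lemma le_mul_one_add_one_div {c : ℝ} (n : ℕ) (hc : 0 ≤ c) :
    c * n ≤ c * n * (1 + 1 / ((n : ℝ) - 1)) := by
  rcases n.eq_zero_or_pos with rfl | hn
  · simp
  · have : (1 : ℝ) ≤ n := by exact_mod_cast hn
    have : 0 ≤ 1 / ((n : ℝ) - 1) := one_div_nonneg.2 (by linarith)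
    exact le_mul_of_one_le_right (by positivity) (by linarith)

end SetFamily

theorem theorem2_general {V : Type*} [DecidableEq V] :
    (∀ (F : Finset (Finset V)) (ν Δ : ℕ),
      (F : Set (Finset V)).Sized 3 → SetFamily.IsLinear F →
      SetFamily.matchingNumber F = ν → SetFamily.maxDegree F = Δ →
      (Δ : ℝ) ≥ 23 / 6 * (ν : ℝ) →
      F.card ≤ Δ * ν) ∧
    (∀ (F : Finset (Finset V)) (ν Δ : ℕ), 0 < ν → 0 < Δ →
      SetFamily.IsDisjointSunflowers F ν Δ →
      (F : Set (Finset V)).Sized 3 ∧ SetFamily.IsLinear F ∧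
      SetFamily.matchingNumber F = ν ∧ SetFamily.maxDegree F = Δ ∧ F.card = Δ * ν) ∧
    (∀ ν Δ : ℕ, ∃ F : Finset (Finset ℕ), SetFamily.IsDisjointSunflowers F ν Δ) := by
  refine ⟨?_, fun F ν Δ hν hΔ hF ↦ hF.extremal hν hΔ, SetFamily.exists_isDisjointSunflowers⟩
  rintro F _ _ hF hL rfl rfl hΔ
  have hnat : (23 * SetFamily.matchingNumber F : ℝ) ≤ 6 * SetFamily.maxDegree F := by linarith
  exact SetFamily.card_le_maxDegree_mul_matchingNumber hF hL (by exact_mod_cast hnat)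

theorem theorem2 {V : Type*} [DecidableEq V] :
    (∀ (F : Finset (Finset V)) (ν Δ : ℕ),
      (F : Set (Finset V)).Sized 3 → SetFamily.IsLinear F →
      SetFamily.matchingNumber F = ν → SetFamily.maxDegree F = Δ → ν ≠ 1 →
      (Δ : ℝ) ≥ 23 / 6 * (ν : ℝ) * (1 + 1 / ((ν : ℝ) - 1)) →
      F.card ≤ Δ * ν) ∧
    (∀ (F : Finset (Finset V)) (ν Δ : ℕ), 0 < ν → 0 < Δ →
      SetFamily.IsDisjointSunflowers F ν Δ →
      (F : Set (Finset V)).Sized 3 ∧ SetFamily.IsLinear F ∧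
      SetFamily.matchingNumber F = ν ∧ SetFamily.maxDegree F = Δ ∧ F.card = Δ * ν) ∧
    (∀ ν Δ : ℕ, 0 < ν → 0 < Δ →
      ∃ F : Finset (Finset ℕ), SetFamily.IsDisjointSunflowers F ν Δ) :=
  ⟨fun F ν Δ hF hL hν hΔ _ h ↦ theorem2_general.1 F ν Δ hF hL hν hΔ
      ((SetFamily.le_mul_one_add_one_div ν (by norm_num)).trans h),
    theorem2_general.2.1, fun ν Δ _ _ ↦ (theorem2_general (V := V)).2.2 ν Δ⟩
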